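/- Let $x\mapsto\rho_x$ be a measurable map from a probability space of data points, with distribution $\mu$, to density matrices of dimension $D$. Let $O$ be an (unknown) Hermitian $D\times D$ matrix with operator norm $\|O\|\le 1$, and put $f(x)=\mathrm{tr}(\rho_xO)$. Let $0\le p<1$ and $\tilde\rho_x=(1-p)\rho_x+pI/D$. Let $N\ge 1$, $\lambda>0$, $\lambda'=\max\{1,\lambda\}$ and $0<\delta<1$. Draw $x_1,\dots,x_N$ independently from $\mu$ and let $\mathbf y=(y_1,\dots,y_N)^T$ with $y_i=f(x_i)$. For each unordered pair $i,j$ (including $i=j$) perform $m$ SWAP-tests on independent copies of $\tilde\rho_{x_i},\tilde\rho_{x_j}$; given the data points the outcomes are independent, and each is a $\{0,1\}$-valued Bernoulli variable with expectation $\mathrm{tr}(\tilde\rho_{x_i}\tilde\rho_{x_j})$. Let $\widehat K_{ij}=\widehat K_{ji}$ be the average of the $m$ outcomes for the pair $i,j$, and let $K_{ij}=\mathrm{tr}(\rho_{x_i}\rho_{x_j})$ be the noiseless kernel matrix. Assume that $$m\ge\frac{8N}{\lambda^2}\log\frac{2N}{\delta}.$$ Then we can find a function $h$ such that, with probability at least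 $1-\delta$ over the choice of $x_1,\dots,x_N$ and the outcomes of the SWAP-tests, $$\mathbb E_{x\sim\mu}\big|h(x)-\mathrm{tr}(\rho_xO)\big|\le C\left(\sqrt{\frac{\lambda'\,\mathbf y^T(K+\lambda I)^{-1}\mathbf y}{(1-p)^2N}}+\sqrt{\frac{\log(1/\delta)}{N}}\right).$$ Here the constant $C$ is uniform for $\delta$ bounded away from $1$: for every $\delta_0<1$ it can be chosen depending only on $\delta_0$, for all $\delta\le\delta_0$ and all values of the other parameters. "We can find" means that there is one measurable rule, depending on neither the encoding map, $p$, $D$, $O$, $\mu$, $\delta$, $m$ nor $\delta_0$, that computes $h(x)$ from $N$, $\lambda$, $\mathbf y$, $\widehat K$ and the noisy kernel values $\mathrm{tr}(\tilde\rho_{x_i}\tilde\rho_x)$, $1\le i\le N$, of the point $x$. -/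

import Mathlib

open MeasureTheory
open scoped Matrix ComplexOrder

noncomputable section

/-- A quantum state of dimension `D`: a positive semidefinite matrix of trace one. -/
def IsDensityMatrix {D : ℕ} (ρ : Matrix (Fin D) (Fin D) ℂ) : Prop :=
  ρ.PosSemidef ∧ ρ.trace = 1

/-- An observable `O` with operator norm `‖O‖ ≤ 1`. -/
def IsBoundedObservable {D : ℕ} (O : Matrix (Fin D) (Fin D) ℂ) : Prop :=
  O.IsHermitian ∧ ‖Matrix.toEuclideanCLM (n := Fin D) (𝕜 := ℂ) O‖ ≤ 1

/-- The number `tr (A B)`, which is real when `A` and `B` are hermitian. -/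
def trProd {D : ℕ} (A B : Matrix (Fin D) (Fin D) ℂ) : ℝ :=
  (A * B).trace.re

/-- The depolarized state `(1 - p) ρ + p I / D`. -/
def depolarize {D : ℕ} (p : ℝ) (ρ : Matrix (Fin D) (Fin D) ℂ) : Matrix (Fin D) (Fin D) ℂ :=
  ((1 - p : ℝ) : ℂ) • ρ + ((p / (D : ℝ) : ℝ) : ℂ) • (1 : Matrix (Fin D) (Fin D) ℂ)

/-- The kernel matrix `tr (ρ_{x_i} ρ_{x_j})` of the data points `x_1, …, x_N`. -/
def kernelMatrix {X : Type*} {D N : ℕ} (ρ : X → Matrix (Fin D) (Fin D) ℂ) (x : Fin N → X) :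
    Matrix (Fin N) (Fin N) ℝ :=
  Matrix.of fun i j => trProd (ρ (x i)) (ρ (x j))

/-- The vector of kernel values `tr (ρ_{x_i} ρ_z)` of a point `z` against the data points. -/
def kernelVector {X : Type*} {D N : ℕ} (ρ : X → Matrix (Fin D) (Fin D) ℂ) (x : Fin N → X)
    (z : X) : Fin N → ℝ :=
  fun i => trProd (ρ (x i)) (ρ z)

/-- The unordered pairs `{i, j}`, with `i = j` allowed, of indices of data points. -/
abbrev IndexPair (N : ℕ) : Type := {ij : Fin N × Fin N // ij.1 ≤ ij.2}

/-- The outcomes of `m` SWAP-tests for each unordered pair (`true` is the outcome `1`). -/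
abbrev SwapOutcomes (N m : ℕ) : Type := IndexPair N → Fin m → Bool

/-- The probability of the outcome `b` of a SWAP-test on the states `σ`, `τ`: the outcome is a
Bernoulli variable with values `0`, `1` and expectation `tr (σ τ)`. -/
def swapProb {D : ℕ} (σ τ : Matrix (Fin D) (Fin D) ℂ) (b : Bool) : ℝ :=
  if b then trProd σ τ else 1 - trProd σ τ

/-- The conditional probability of the outcomes `R`, given the data points `x`, where `σ` is the
map that sends a point to the state on which the tests are performed. All tests are independent. -/
def outcomeProb {X : Type*} {D N m : ℕ} (σ : X → Matrix (Fin D) (Fin D) ℂ) (x : Fin N → X)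
    (R : SwapOutcomes N m) : ℝ :=
  ∏ ij : IndexPair N, ∏ k : Fin m, swapProb (σ (x ij.1.1)) (σ (x ij.1.2)) (R ij k)

/-- The joint law of the data points (independent with law `μ`) and of the outcomes of the
SWAP-tests: `P (x ∈ S, R = r) = ∫_S outcomeProb σ x r dμ^N(x)`. -/
def experimentLaw {X : Type*} [MeasurableSpace X] {D : ℕ} (μ : Measure X)
    (σ : X → Matrix (Fin D) (Fin D) ℂ) (N m : ℕ) : Measure ((Fin N → X) × SwapOutcomes N m) :=
  ∑ r : SwapOutcomes N m,
    ((Measure.pi fun _ : Fin N => μ).withDensity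
      fun x => ENNReal.ofReal (outcomeProb σ x r)).map fun x => (x, r)

/-- The estimated kernel matrix: every entry is the average of its `m` SWAP-test outcomes. -/
def estimatedKernel {N m : ℕ} (R : SwapOutcomes N m) : Matrix (Fin N) (Fin N) ℝ :=
  Matrix.of fun i j =>
    (∑ k : Fin m, if R ⟨(min i j, max i j), min_le_max⟩ k then (1 : ℝ) else 0) / (m : ℝ)

/-- A kernel learning rule. From the regularization parameter `lam`, the labels `y`, an estimate
`Khat` of the kernel matrix, and the kernel values `k` of a point `z` against the training points,
it computes the value at `z` of the hypothesis. -/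
abbrev KernelLearner : Type :=
  (N : ℕ) → (lam : ℝ) → (y : Fin N → ℝ) → (Khat : Fin N → Fin N → ℝ) → (k : Fin N → ℝ) → ℝ

/-- The rule is a measurable function of all its real inputs. -/
def KernelLearner.IsMeasurable (A : KernelLearner) : Prop :=
  ∀ (N : ℕ) (lam : ℝ),
    Measurable fun w : (Fin N → ℝ) × (Fin N → Fin N → ℝ) × (Fin N → ℝ) => A N lam w.1 w.2.1 w.2.2

end

open ProbabilityTheory

/-! The hypothesis is an online-to-batch average: for each t < N, kernel ridge regression with
regularization 5λ is trained on the first t points and the estimated kernel K̂, its prediction is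
clipped to [-1, 1], and the N predictors are averaged. The t-th predictor has not seen x_t, so its
loss at x_t has the risk as conditional mean, and Azuma's inequality (`measure_lossExcess_ge_le`)
bounds the total risk by the total observed loss plus √(2N log(2/δ)).

The observed losses are bounded deterministically (`sum_sq_residual_le`). Let M = K̂ + 5λI. The
potential yᵀM⁻¹y of the leading blocks grows by at least r²/(1 + 5λ) when a point with residual r is
added (`sum_sq_sub_mulVec_le`), so the squared residuals sum to at most (1 + 5λ) yᵀM⁻¹y. Two
discrepancies between K̂ and the noisy kernel matrix K̃ remain. First, a net argument gives |uᵀ(K̂ -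
K̃)v| ≤ 4λ|u||v| (`measure_badKernel_le`). Since K̃ ≥ (1-p)²K as forms, M ≥ K̃ + λI ≥ (1-p)²(K +
λI), which compares the potential with the noiseless one; this is why 5λ is used. Second, the t-th
predictor is evaluated with exact entries of K̃, whereas the potential argument uses column t of K̂.
The weights depend only on tests between earlier points, so Hoeffding conditionally on those tests
bounds the difference by λ|w|/√N (`measure_badColumn_le`); the operator bound 4λ|w| would lose a
factor N in the sum of squares.

The argument conditions in both directions. Each SWAP-test outcome is therefore realized as the
event that a uniform threshold, independent of the data, is at most tr(σσ')
(`experimentLaw_eq_map`). For fixed thresholds the points are still i.i.d.; for fixed points the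
outcomes are independent Bernoulli variables. -/

/-- The dual weights `(K + 5 lam I)⁻¹ y` of kernel ridge regression. -/
noncomputable def ridgeWeights {n : ℕ} (lam : ℝ) (y : Fin n → ℝ) (K : Fin n → Fin n → ℝ) :
    Fin n → ℝ :=
  (Matrix.of K + (5 * lam) • (1 : Matrix (Fin n) (Fin n) ℝ))⁻¹ *ᵥ y

/-! ### Quadratic forms and their inverses. -/

section Quadratic

variable {n : Type*} [Fintype n]

theorem dotProduct_mulVec_add_smul {M : Matrix n n ℝ} (hM : M.IsSymm) (v w : n → ℝ) (c : ℝ) :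
    (v + c • w) ⬝ᵥ M *ᵥ (v + c • w) =
      v ⬝ᵥ M *ᵥ v + 2 * c * (w ⬝ᵥ M *ᵥ v) + c ^ 2 * (w ⬝ᵥ M *ᵥ w) := by
  have h : v ⬝ᵥ M *ᵥ w = w ⬝ᵥ M *ᵥ v := by
    rw [Matrix.dotProduct_mulVec, ← Matrix.mulVec_transpose, hM, dotProduct_comm]
  simp only [Matrix.mulVec_add, Matrix.mulVec_smul, add_dotProduct, dotProduct_add,
    smul_dotProduct, dotProduct_smul, smul_eq_mul, h]
  ring

theorem isUnit_det_of_forall_pos [DecidableEq n] {M : Matrix n n ℝ}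
    (h : ∀ v, v ≠ 0 → 0 < v ⬝ᵥ M *ᵥ v) : IsUnit M.det := by
  rw [isUnit_iff_ne_zero]
  intro h0
  obtain ⟨v, hv, hMv⟩ := Matrix.exists_mulVec_eq_zero_iff.mpr h0
  have := h v hv
  simp [hMv] at this

theorem mulVec_inv_mulVec [DecidableEq n] {M : Matrix n n ℝ}
    (h : ∀ v, v ≠ 0 → 0 < v ⬝ᵥ M *ᵥ v) (y : n → ℝ) : M *ᵥ (M⁻¹ *ᵥ y) = y := by
  rw [Matrix.mulVec_mulVec, Matrix.mul_nonsing_inv _ (isUnit_det_of_forall_pos h),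
    Matrix.one_mulVec]

/-- The variational characterization of `aᵀ y` when `a` interpolates `y` in the geometry of `M`
along `a` and along `v`. -/
theorem two_mul_dotProduct_sub_le {M : Matrix n n ℝ} (hM : M.IsSymm)
    (hpos : ∀ v, 0 ≤ v ⬝ᵥ M *ᵥ v) {a v y : n → ℝ} (ha : a ⬝ᵥ M *ᵥ a = a ⬝ᵥ y)
    (hv : v ⬝ᵥ M *ᵥ a = v ⬝ᵥ y) : 2 * (v ⬝ᵥ y) - v ⬝ᵥ M *ᵥ v ≤ a ⬝ᵥ y := by
  -- This is the nonnegativity of (a - v)ᵀM(a - v).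
  have h := hpos (a + (-1 : ℝ) • v)
  rw [dotProduct_mulVec_add_smul hM, ha, hv] at h
  linarith

/-- Expanding (g - qa)ᵀG(g - qa) ≥ 0 with g = G⁻¹y gives the bound. It replaces the antitonicity of
the matrix inverse: M ≥ qG is needed only at the single vector a = M⁻¹y. -/
theorem dotProduct_le_of_quadratic_le [DecidableEq n] {G : Matrix n n ℝ} (hG : G.IsSymm)
    (hpos : ∀ v, v ≠ 0 → 0 < v ⬝ᵥ G *ᵥ v) {q : ℝ} (hq : 0 < q) {a y : n → ℝ}
    (ha : q * (a ⬝ᵥ G *ᵥ a) ≤ a ⬝ᵥ y) : a ⬝ᵥ y ≤ (y ⬝ᵥ G⁻¹ *ᵥ y) / q := by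
  have hy := mulVec_inv_mulVec hpos y
  set g := G⁻¹ *ᵥ y
  have hnn : ∀ v, 0 ≤ v ⬝ᵥ G *ᵥ v := fun v => by
    by_cases hv : v = 0
    · simp [hv]
    · exact (hpos v hv).le
  have h := hnn (g + (-q) • a)
  rw [dotProduct_mulVec_add_smul hG, hy, dotProduct_comm g y] at h
  rw [le_div_iff₀ hq]
  nlinarith

end Quadratic

/-! ### Deterministic bound for the online residuals. -/

section Online

variable {N : ℕ}

theorem dotProduct_eq_of_support {u v w : Fin N → ℝ} (h : ∀ j, u j ≠ 0 → v j = w j) :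
    u ⬝ᵥ v = u ⬝ᵥ w := by
  refine Finset.sum_congr rfl fun j _ => ?_
  by_cases hj : u j = 0
  · simp [hj]
  · rw [h j hj]

/-- The potential a_t ⬝ y is the maximum of 2vᵀy - vᵀMv over vectors supported on the first t
coordinates. Moving from a_t along the new coordinate shows that it rises by at least r²/d when a
residual r is met; the increments telescope. -/
theorem sum_sq_sub_mulVec_le {M : Matrix (Fin N) (Fin N) ℝ} (hM : M.IsSymm)
    (hpos : ∀ v, 0 ≤ v ⬝ᵥ M *ᵥ v) {d : ℝ} (hd : 0 < d) (hdiag : ∀ j, M j j ≤ d)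
    {a : ℕ → Fin N → ℝ} {y : Fin N → ℝ}
    (hsupp : ∀ (t : ℕ) (j : Fin N), t ≤ j → a t j = 0)
    (hint : ∀ t ≤ N, ∀ j : Fin N, (j : ℕ) < t → (M *ᵥ a t) j = y j) :
    ∀ t ≤ N, ∑ j : Fin N, (if (j : ℕ) < t then (y j - (M *ᵥ a j) j) ^ 2 else 0) ≤
      d * (a t ⬝ᵥ y) := by
  intro t
  induction t with
  | zero =>
    intro _
    have : a 0 = 0 := funext fun j => hsupp 0 j (Nat.zero_le _)
    simp [this]
  | succ t ih =>
    intro ht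
    have hsup : ∀ s ≤ t + 1, ∀ j : Fin N, a s j ≠ 0 → (j : ℕ) < t + 1 := fun s hs j hj => by
      by_contra hlt
      exact hj (hsupp s j (by omega))
    have hdot : ∀ s ≤ N, a s ⬝ᵥ M *ᵥ a s = a s ⬝ᵥ y := fun s hs =>
      dotProduct_eq_of_support fun j hj => hint s hs j (by
        by_contra hlt
        exact hj (hsupp s j (by omega)))
    let k : Fin N := ⟨t, ht⟩
    set r := y k - (M *ᵥ a t) k with hr
    -- The step c = r/d maximizes 2cr - c²d, a lower bound of the gain 2cr - c² M k k; its value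
    -- there is r²/d.
    have hv : (a t + (r / d) • Pi.single k (1 : ℝ)) ⬝ᵥ M *ᵥ a (t + 1) =
        (a t + (r / d) • Pi.single k (1 : ℝ)) ⬝ᵥ y := by
      refine dotProduct_eq_of_support fun j hj => hint (t + 1) ht j ?_
      by_contra hlt
      apply hj
      have h1 : a t j = 0 := hsupp t j (by omega)
      have h2 : j ≠ k := fun h => hlt (by simp [h, k])
      simp [h1, h2]
    have h := two_mul_dotProduct_sub_le hM hpos (hdot (t + 1) ht) hv
    rw [dotProduct_mulVec_add_smul hM, hdot t (by omega)] at h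
    simp only [add_dotProduct, smul_dotProduct, single_dotProduct, Matrix.mulVec_single_one,
      one_mul, smul_eq_mul, Matrix.col_apply] at h
    have hsplit : ∑ j : Fin N, (if (j : ℕ) < t + 1 then (y j - (M *ᵥ a j) j) ^ 2 else 0) =
        ∑ j : Fin N, (if (j : ℕ) < t then (y j - (M *ᵥ a j) j) ^ 2 else 0) + r ^ 2 := by
      have : r ^ 2 = ∑ j : Fin N, if j = k then (y j - (M *ᵥ a j) j) ^ 2 else 0 := by
        simp [hr, k]
      rw [this, ← Finset.sum_add_distrib]
      refine Finset.sum_congr rfl fun j _ => ?_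
      have : j = k ↔ (j : ℕ) = t := by simp [k, Fin.ext_iff]
      rcases lt_trichotomy (j : ℕ) t with hj | hj | hj
      · simp [this, hj, hj.ne, hj.trans (Nat.lt_succ_self t)]
      · simp [this, hj]
      · simp [this, hj.ne', hj.not_gt, show ¬ (j : ℕ) < t + 1 by omega]
    rw [hsplit]
    have hdk := hdiag k
    have e1 : d * (r / d) ^ 2 * M k k ≤ d * (r / d) ^ 2 * d := by gcongr
    have e2 : d * (r / d) ^ 2 * d = r ^ 2 := by field_simp
    have e3 : d * (r / d) = r := by field_simp
    have := ih (by omega)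
    have h' := mul_le_mul_of_nonneg_left h hd.le
    have e4 : r * (y k - (M *ᵥ a t) k) = r * r := by rw [hr]
    have e5 : d * (r / d) * (y k - (M *ᵥ a t) k) = r * r := by rw [e3, e4]
    nlinarith

/-- The first `t` entries of a family of length `N`, for `t ≤ N`. -/
def initialSegment {N : ℕ} {α : Type*} (x : Fin N → α) {t : ℕ} (ht : t ≤ N) : Fin t → α :=
  fun i => x (Fin.castLE ht i)

/-- The leading `t × t` block of a matrix, for `t ≤ N`. -/
def leadingBlock (K : Fin N → Fin N → ℝ) {t : ℕ} (ht : t ≤ N) : Fin t → Fin t → ℝ :=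
  fun i j => K (Fin.castLE ht i) (Fin.castLE ht j)

/-- Extension of a vector by zero. -/
def extendZero {t : ℕ} (v : Fin t → ℝ) : Fin N → ℝ :=
  fun j => if h : (j : ℕ) < t then v ⟨j, h⟩ else 0

theorem sum_extendZero_mul {t : ℕ} (ht : t ≤ N) (v : Fin t → ℝ) (F : Fin N → ℝ) :
    ∑ j, extendZero v j * F j = ∑ i, v i * F (Fin.castLE ht i) := by
  symm
  refine Finset.sum_of_injOn (Fin.castLE ht) (Fin.castLE_injective ht).injOn (by simp) ?_ ?_
  · intro j _ hj
    have : ¬ (j : ℕ) < t := fun h => hj ⟨⟨j, h⟩, by simp, by simp⟩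
    simp [extendZero, this]
  · intro i _
    simp [extendZero]

theorem extendZero_dotProduct_self {t : ℕ} (ht : t ≤ N) (v : Fin t → ℝ) :
    (extendZero v : Fin N → ℝ) ⬝ᵥ extendZero v = ∑ i, v i ^ 2 := by
  rw [dotProduct, sum_extendZero_mul ht]
  exact Finset.sum_congr rfl fun i _ => by simp [extendZero, sq]

theorem mulVec_extendZero {t : ℕ} (ht : t ≤ N) (M : Matrix (Fin N) (Fin N) ℝ) (v : Fin t → ℝ)
    (j : Fin N) : (M *ᵥ extendZero v) j = ∑ i, v i * M j (Fin.castLE ht i) := by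
  rw [← sum_extendZero_mul ht v fun i => M j i]
  rw [Matrix.mulVec, dotProduct_comm, dotProduct]

/-- Here q stands for (1 - p)², `G` for K + λI, `Kh` for the estimated and `Kn` for the exact noisy
kernel matrix. Each residual against `Kn` is the residual against `Kh` plus a column error. The
former are controlled by the potential, the latter by `herr` and λ|w|² ≤ wᵀMw ≤ Q, where Q is the
final potential. -/
theorem sum_sq_residual_le {lam q : ℝ} (hlam : 0 < lam) (hq : 0 < q)
    {Kn Kh G : Matrix (Fin N) (Fin N) ℝ} (hG : G.IsSymm)
    (hGpos : ∀ v, v ≠ 0 → 0 < v ⬝ᵥ G *ᵥ v) (hKh : Kh.IsSymm)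
    (hGM : ∀ v, q * (v ⬝ᵥ G *ᵥ v) ≤
      v ⬝ᵥ (Kh + (5 * lam) • (1 : Matrix (Fin N) (Fin N) ℝ)) *ᵥ v)
    (hMlam : ∀ v, lam * (v ⬝ᵥ v) ≤
      v ⬝ᵥ (Kh + (5 * lam) • (1 : Matrix (Fin N) (Fin N) ℝ)) *ᵥ v)
    (hdiag : ∀ i, Kh i i ≤ 1) (y : Fin N → ℝ) (w : (t : Fin N) → Fin t → ℝ)
    (hw : ∀ t : Fin N, w t = ridgeWeights lam (initialSegment y t.2.le) (leadingBlock Kh t.2.le))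
    (herr : ∀ t : Fin N, (∑ i, w t i * (Kh (Fin.castLE t.2.le i) t - Kn (Fin.castLE t.2.le i) t)) ^ 2
      ≤ lam ^ 2 / N * ∑ i, w t i ^ 2) :
    ∑ t : Fin N, (y t - ∑ i, w t i * Kn (Fin.castLE t.2.le i) t) ^ 2 ≤
      14 * (max 1 lam * (y ⬝ᵥ G⁻¹ *ᵥ y) / q) := by
  set M := Kh + (5 * lam) • (1 : Matrix (Fin N) (Fin N) ℝ) with hMdef
  have hM : M.IsSymm := hKh.add (Matrix.isSymm_one.smul _)
  have hpos : ∀ v, 0 ≤ v ⬝ᵥ M *ᵥ v := fun v =>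
    le_trans (mul_nonneg hlam.le (Finset.sum_nonneg fun i _ => mul_self_nonneg (v i))) (hMlam v)
  let a : ℕ → Fin N → ℝ := fun t => if ht : t ≤ N then
    extendZero (ridgeWeights lam (initialSegment y ht) (leadingBlock Kh ht)) else 0
  have hat : ∀ (t : ℕ) (ht : t ≤ N), a t =
    extendZero (ridgeWeights lam (initialSegment y ht) (leadingBlock Kh ht)) := fun t ht => by
      simp [a, ht]
  have hsupp : ∀ (t : ℕ) (j : Fin N), t ≤ j → a t j = 0 := fun t j htj => by
    have : t ≤ N := htj.trans j.2.le
    simp [hat t this, extendZero, htj.not_gt]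
  have hblock : ∀ (t : ℕ) (ht : t ≤ N) (v : Fin t → ℝ) (i : Fin t),
      ((Matrix.of (leadingBlock Kh ht) + (5 * lam) • (1 : Matrix (Fin t) (Fin t) ℝ)) *ᵥ v) i =
        (M *ᵥ extendZero v) (Fin.castLE ht i) := fun t ht v i => by
    rw [mulVec_extendZero ht, Matrix.mulVec, dotProduct]
    refine Finset.sum_congr rfl fun j _ => ?_
    simp [hMdef, leadingBlock, Matrix.one_apply, mul_comm]
  have hint : ∀ t ≤ N, ∀ j : Fin N, (j : ℕ) < t → (M *ᵥ a t) j = y j := fun t ht j hj => by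
    have hp : ∀ v : Fin t → ℝ, v ≠ 0 → 0 < v ⬝ᵥ
        (Matrix.of (leadingBlock Kh ht) + (5 * lam) • (1 : Matrix (Fin t) (Fin t) ℝ)) *ᵥ v := by
      intro v hv
      have h1 : v ⬝ᵥ (Matrix.of (leadingBlock Kh ht) +
          (5 * lam) • (1 : Matrix (Fin t) (Fin t) ℝ)) *ᵥ v =
          (extendZero v : Fin N → ℝ) ⬝ᵥ M *ᵥ extendZero v := by
        rw [dotProduct, dotProduct, sum_extendZero_mul ht]
        exact Finset.sum_congr rfl fun i _ => by rw [hblock t ht v i]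
      rw [h1]
      refine lt_of_lt_of_le (mul_pos hlam ?_) (hMlam _)
      rw [extendZero_dotProduct_self ht]
      obtain ⟨i, hi⟩ := Function.ne_iff.mp hv
      exact Finset.sum_pos' (fun i _ => sq_nonneg _) ⟨i, Finset.mem_univ _, sq_pos_of_ne_zero hi⟩
    have h2 := congrFun (mulVec_inv_mulVec hp (initialSegment y ht)) ⟨j, hj⟩
    have h3 := hblock t ht (ridgeWeights lam (initialSegment y ht) (leadingBlock Kh ht)) ⟨j, hj⟩
    rw [hat t ht]
    exact h3.symm.trans h2
  have hdot : ∀ s ≤ N, a s ⬝ᵥ M *ᵥ a s = a s ⬝ᵥ y := fun s hs =>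
    dotProduct_eq_of_support fun j hj => hint s hs j (by
      by_contra hlt
      exact hj (hsupp s j (by omega)))
  -- The diagonal of M is at most 1 + 5λ, which is the origin of the factor max(1, λ).
  have hres := sum_sq_sub_mulVec_le (d := 1 + 5 * lam) hM hpos (by positivity)
    (fun j => by simpa [hMdef] using hdiag j) hsupp hint N le_rfl
  have hQt : ∀ t ≤ N, a t ⬝ᵥ y ≤ a N ⬝ᵥ y := fun t ht => by
    have := two_mul_dotProduct_sub_le hM hpos (hdot N le_rfl) (v := a t)
      (dotProduct_eq_of_support fun j _ => hint N le_rfl j j.2)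
    rw [hdot t ht] at this
    linarith
  have hQN : a N ⬝ᵥ y ≤ (y ⬝ᵥ G⁻¹ *ᵥ y) / q :=
    dotProduct_le_of_quadratic_le hG hGpos hq ((hGM _).trans_eq (hdot N le_rfl))
  have hQ0 : 0 ≤ a N ⬝ᵥ y := (hpos _).trans_eq (hdot N le_rfl)
  set Q := a N ⬝ᵥ y
  simp only [Fin.is_lt, if_true] at hres
  have hterm : ∀ t : Fin N, (y t - ∑ i, w t i * Kn (Fin.castLE t.2.le i) t) ^ 2 ≤
      2 * (y t - (M *ᵥ a t) t) ^ 2 + 2 * (lam * Q / N) := fun t => by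
    have ha : a t = extendZero (w t) := by rw [hat t t.2.le, hw]
    have hM1 : (M *ᵥ a t) t = ∑ i, w t i * Kh (Fin.castLE t.2.le i) t := by
      rw [ha, mulVec_extendZero t.2.le]
      refine Finset.sum_congr rfl fun i _ => ?_
      -- The weights live on indices below t, so the diagonal term 5λ never enters row t.
      have hne : t ≠ Fin.castLE t.2.le i := fun h => by
        have := congrArg Fin.val h
        simp at this
        omega
      have := hKh.apply t (Fin.castLE t.2.le i)
      simp [hMdef, hne, this]
    have hnorm : lam * ∑ i, w t i ^ 2 ≤ Q := by
      rw [← extendZero_dotProduct_self t.2.le, ← ha]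
      exact (hMlam _).trans ((hdot t t.2.le).trans_le (hQt t t.2.le))
    have h1 : (∑ i, w t i * (Kh (Fin.castLE t.2.le i) t - Kn (Fin.castLE t.2.le i) t)) ^ 2 ≤
        lam * Q / N := by
      refine (herr t).trans ?_
      calc lam ^ 2 / N * ∑ i, w t i ^ 2 = lam / N * (lam * ∑ i, w t i ^ 2) := by ring
        _ ≤ lam / N * Q := by gcongr
        _ = lam * Q / N := by ring
    simp only [mul_sub, Finset.sum_sub_distrib, ← hM1] at h1
    -- This is (A + B)² ≤ 2A² + 2B² with A the residual against `Kh` and B the column error.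
    nlinarith [sq_nonneg ((y t - (M *ᵥ a t) t) -
      ((M *ᵥ a t) t - ∑ i, w t i * Kn (Fin.castLE t.2.le i) t))]
  have hN : ∑ _t : Fin N, 2 * (lam * Q / N) ≤ 2 * (lam * Q) := by
    rcases Nat.eq_zero_or_pos N with h | h
    · subst h
      simpa using by positivity
    · have : (N : ℝ) ≠ 0 := by positivity
      simp only [Finset.sum_const, Finset.card_univ, Fintype.card_fin, nsmul_eq_mul]
      field_simp
      exact le_rfl
  calc _ ≤ ∑ t : Fin N, (2 * (y t - (M *ᵥ a t) t) ^ 2 + 2 * (lam * Q / N)) :=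
        Finset.sum_le_sum fun t _ => hterm t
    _ ≤ 2 * ((1 + 5 * lam) * Q) + 2 * (lam * Q) := by
        rw [Finset.sum_add_distrib, ← Finset.mul_sum]
        gcongr
    -- The sum is (2 + 12λ)Q.
    _ ≤ 14 * (max 1 lam * Q) := by
        have h1 := le_max_left 1 lam
        have h2 := le_max_right 1 lam
        nlinarith
    _ ≤ 14 * (max 1 lam * ((y ⬝ᵥ G⁻¹ *ᵥ y) / q)) := by gcongr
    _ = _ := by ring

end Online

/-! ### Traces of products of states, depolarization and Gram matrices. -/

section States

variable {D : ℕ}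

theorem trProd_comm (A B : Matrix (Fin D) (Fin D) ℂ) : trProd A B = trProd B A := by
  rw [trProd, Matrix.trace_mul_comm, trProd]

theorem exists_conjTranspose_mul_self {A : Matrix (Fin D) (Fin D) ℂ} (hA : A.PosSemidef) :
    ∃ B : Matrix (Fin D) (Fin D) ℂ, A = Bᴴ * B := by
  open scoped MatrixOrder in
  exact CStarAlgebra.nonneg_iff_eq_star_mul_self.mp (Matrix.nonneg_iff_posSemidef.mpr hA)

theorem trProd_nonneg {A B : Matrix (Fin D) (Fin D) ℂ} (hA : A.PosSemidef) (hB : B.PosSemidef) :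
    0 ≤ trProd A B := by
  obtain ⟨C, rfl⟩ := exists_conjTranspose_mul_self hA
  rw [trProd, Matrix.mul_assoc, Matrix.trace_mul_comm]
  exact (Complex.le_def.mp (hB.mul_mul_conjTranspose_same C).trace_nonneg).1

theorem trace_conjTranspose_mul_self_re (A : Matrix (Fin D) (Fin D) ℂ) :
    (Aᴴ * A).trace.re = ∑ i, ∑ j, ‖A i j‖ ^ 2 := by
  rw [Finset.sum_comm]
  simp [Matrix.trace, Matrix.mul_apply, ← Complex.normSq_eq_norm_sq, Complex.normSq_apply]

/-- With A = P*P and B = Q*Q the trace is the squared Frobenius norm of PQ*, which Cauchy-Schwarz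
bounds by tr A · tr B. -/
theorem trProd_le_one {A B : Matrix (Fin D) (Fin D) ℂ} (hA : IsDensityMatrix A)
    (hB : IsDensityMatrix B) : trProd A B ≤ 1 := by
  obtain ⟨hA, hA1⟩ := hA
  obtain ⟨hB, hB1⟩ := hB
  obtain ⟨P, rfl⟩ := exists_conjTranspose_mul_self hA
  obtain ⟨Q, rfl⟩ := exists_conjTranspose_mul_self hB
  have h : trProd (Pᴴ * P) (Qᴴ * Q) = ((P * Qᴴ)ᴴ * (P * Qᴴ)).trace.re := by
    rw [trProd, ← Matrix.mul_assoc, Matrix.trace_mul_comm, Matrix.conjTranspose_mul,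
      Matrix.conjTranspose_conjTranspose]
    simp only [Matrix.mul_assoc]
  have hP := congrArg Complex.re hA1
  have hQ := congrArg Complex.re hB1
  rw [trace_conjTranspose_mul_self_re] at hP hQ
  rw [h, trace_conjTranspose_mul_self_re]
  calc ∑ i, ∑ j, ‖(P * Qᴴ) i j‖ ^ 2
      ≤ ∑ i, ∑ j, (∑ k, ‖P i k‖ ^ 2) * ∑ k, ‖Q j k‖ ^ 2 := by
        refine Finset.sum_le_sum fun i _ => Finset.sum_le_sum fun j _ => ?_
        calc ‖(P * Qᴴ) i j‖ ^ 2 ≤ (∑ k, ‖P i k‖ * ‖Q j k‖) ^ 2 := by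
              gcongr
              rw [Matrix.mul_apply]
              exact (norm_sum_le _ _).trans_eq (by simp)
          _ ≤ _ := Finset.sum_mul_sq_le_sq_mul_sq _ _ _
    _ = 1 := by
        simp only [← Finset.mul_sum, ← Finset.sum_mul, hP, hQ]
        simp

theorem trProd_add_right (A B C : Matrix (Fin D) (Fin D) ℂ) :
    trProd A (B + C) = trProd A B + trProd A C := by
  simp [trProd, Matrix.mul_add]

theorem trProd_smul_right (c : ℝ) (A B : Matrix (Fin D) (Fin D) ℂ) :
    trProd A ((c : ℂ) • B) = c * trProd A B := by
  simp [trProd]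

theorem abs_trProd_le_one {ρ O : Matrix (Fin D) (Fin D) ℂ} (hρ : IsDensityMatrix ρ)
    (hO : IsBoundedObservable O) : |trProd ρ O| ≤ 1 := by
  obtain ⟨hO, hO1⟩ := hO
  obtain ⟨hρ, hρ1⟩ := hρ
  have h1 : trProd ρ 1 = 1 := by simp [trProd, hρ1]
  have key : ∀ P : Matrix (Fin D) (Fin D) ℂ, P.IsHermitian →
      ‖Matrix.toEuclideanCLM (n := Fin D) (𝕜 := ℂ) P‖ ≤ 1 → trProd ρ P ≤ 1 := by
    intro P hP hP1
    -- A Hermitian P satisfies P ≤ ‖P‖·1 in the C*-order, so tr(ρ(1 - P)) ≥ 0. Applying this to O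
    -- and -O gives both signs.
    have hps : (1 - P).PosSemidef := by
      open scoped MatrixOrder Matrix.Norms.L2Operator in
      rw [← Matrix.le_iff]
      have h : P ≤ algebraMap ℝ _ ‖P‖ :=
        IsSelfAdjoint.le_algebraMap_norm_self (a := P) hP
      refine h.trans ?_
      rw [← map_one (algebraMap ℝ (Matrix (Fin D) (Fin D) ℂ))]
      exact algebraMap_mono _ hP1
    have := trProd_nonneg hρ hps
    rw [sub_eq_add_neg, trProd_add_right, h1] at this
    have h2 : trProd ρ (-P) = - trProd ρ P := by simp [trProd]
    linarith
  rw [abs_le]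
  constructor
  · have := key (-O) hO.neg (by rwa [map_neg, norm_neg])
    have h2 : trProd ρ (-O) = - trProd ρ O := by simp [trProd]
    linarith
  · exact key O hO hO1

theorem IsDensityMatrix.dim_pos {ρ : Matrix (Fin D) (Fin D) ℂ} (hρ : IsDensityMatrix ρ) :
    0 < D := by
  rcases Nat.eq_zero_or_pos D with rfl | h
  · have := hρ.2
    simp [Matrix.trace] at this
  · exact h

theorem IsDensityMatrix.depolarize {ρ : Matrix (Fin D) (Fin D) ℂ} (hρ : IsDensityMatrix ρ) {p : ℝ}
    (hp0 : 0 ≤ p) (hp1 : p < 1) : IsDensityMatrix (depolarize p ρ) := by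
  have hD := hρ.dim_pos
  refine ⟨?_, ?_⟩
  · refine (hρ.1.smul ?_).add (Matrix.PosSemidef.one.smul ?_)
    · exact Complex.zero_le_real.mpr (by linarith)
    · exact Complex.zero_le_real.mpr (by positivity)
  · have : (D : ℂ) ≠ 0 := by exact_mod_cast hD.ne'
    simp [_root_.depolarize, hρ.2]
    field_simp
    ring

theorem trProd_depolarize {ρ τ : Matrix (Fin D) (Fin D) ℂ} (hρ : IsDensityMatrix ρ)
    (hτ : IsDensityMatrix τ) (p : ℝ) : trProd (depolarize p ρ) (depolarize p τ) =
      (1 - p) ^ 2 * trProd ρ τ + (2 * p - p ^ 2) / D := by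
  have hD : (D : ℝ) ≠ 0 := by exact_mod_cast hρ.dim_pos.ne'
  have h1 : ∀ {σ : Matrix (Fin D) (Fin D) ℂ}, IsDensityMatrix σ → trProd σ 1 = 1 := fun h => by
    simp [trProd, h.2]
  have h11 : trProd (1 : Matrix (Fin D) (Fin D) ℂ) 1 = D := by simp [trProd]
  have h : ∀ A σ : Matrix (Fin D) (Fin D) ℂ, trProd A (depolarize p σ) =
      (1 - p) * trProd A σ + p / D * trProd A 1 := fun A σ => by
    rw [depolarize, trProd_add_right, trProd_smul_right, trProd_smul_right]
  rw [h, trProd_comm _ τ, trProd_comm _ 1, h, h, trProd_comm 1 ρ, h1 hρ, h1 hτ, h11,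
    trProd_comm τ ρ]
  field_simp
  ring

theorem trProd_sum_sum {N : ℕ} (A : Fin N → Matrix (Fin D) (Fin D) ℂ) (v : Fin N → ℝ) :
    trProd (∑ i, (v i : ℂ) • A i) (∑ i, (v i : ℂ) • A i) =
      ∑ i, ∑ j, v i * v j * trProd (A i) (A j) := by
  simp only [trProd, Matrix.sum_mul, Matrix.mul_sum, Matrix.trace_sum, Complex.re_sum]
  rw [Finset.sum_comm]
  refine Finset.sum_congr rfl fun i _ => Finset.sum_congr rfl fun j _ => ?_
  rw [Matrix.smul_mul, Matrix.mul_smul, smul_smul, Matrix.trace_smul, smul_eq_mul,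
    ← Complex.ofReal_mul, Complex.re_ofReal_mul]

theorem trProd_self_nonneg {A : Matrix (Fin D) (Fin D) ℂ} (hA : A.IsHermitian) :
    0 ≤ trProd A A := by
  have h := trace_conjTranspose_mul_self_re A
  rw [hA.eq] at h
  rw [trProd, h]
  positivity

variable {X : Type*} {N : ℕ}

theorem kernelMatrix_isSymm (ρ : X → Matrix (Fin D) (Fin D) ℂ) (x : Fin N → X) :
    (kernelMatrix ρ x).IsSymm := by
  ext i j
  simp [kernelMatrix, trProd_comm]

/-- A Gram matrix: the form at v is tr(A²) for the Hermitian matrix A = Σ v_i ρ(x_i). -/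
theorem kernelMatrix_quadratic_nonneg {ρ : X → Matrix (Fin D) (Fin D) ℂ}
    (hρ : ∀ x, IsDensityMatrix (ρ x)) (x : Fin N → X) (v : Fin N → ℝ) :
    0 ≤ v ⬝ᵥ kernelMatrix ρ x *ᵥ v := by
  have h : v ⬝ᵥ kernelMatrix ρ x *ᵥ v =
      trProd (∑ i, (v i : ℂ) • ρ (x i)) (∑ i, (v i : ℂ) • ρ (x i)) := by
    rw [trProd_sum_sum]
    simp only [dotProduct, Matrix.mulVec, kernelMatrix, Matrix.of_apply, Finset.mul_sum]
    exact Finset.sum_congr rfl fun i _ => Finset.sum_congr rfl fun j _ => by ring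
  rw [h]
  refine trProd_self_nonneg ?_
  rw [Matrix.IsHermitian, Matrix.conjTranspose_sum]
  refine Finset.sum_congr rfl fun i _ => ?_
  rw [Matrix.conjTranspose_smul, (hρ (x i)).1.isHermitian.eq]
  simp

/-- Depolarization scales the kernel matrix by (1 - p)² and adds a nonnegative multiple of the
all-ones matrix, which is positive semidefinite. -/
theorem kernelMatrix_depolarize_quadratic {ρ : X → Matrix (Fin D) (Fin D) ℂ}
    (hρ : ∀ x, IsDensityMatrix (ρ x)) {p : ℝ} (hp0 : 0 ≤ p) (hp1 : p < 1) (x : Fin N → X)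
    (v : Fin N → ℝ) : (1 - p) ^ 2 * (v ⬝ᵥ kernelMatrix ρ x *ᵥ v) ≤
      v ⬝ᵥ kernelMatrix (fun z => depolarize p (ρ z)) x *ᵥ v := by
  have h : v ⬝ᵥ kernelMatrix (fun z => depolarize p (ρ z)) x *ᵥ v =
      (1 - p) ^ 2 * (v ⬝ᵥ kernelMatrix ρ x *ᵥ v) + (2 * p - p ^ 2) / D * (∑ i, v i) ^ 2 := by
    rw [sq (∑ i, v i), Finset.sum_mul_sum]
    simp only [dotProduct, Matrix.mulVec, kernelMatrix, Matrix.of_apply, Finset.mul_sum,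
      ← Finset.sum_add_distrib]
    refine Finset.sum_congr rfl fun i _ => Finset.sum_congr rfl fun j _ => ?_
    rw [trProd_depolarize (hρ _) (hρ _)]
    ring
  have : 0 ≤ 2 * p - p ^ 2 := by nlinarith
  rw [h]
  exact le_add_of_nonneg_right (by positivity)

theorem measurable_trProd {Y : Type*} [MeasurableSpace Y] {A B : Y → Matrix (Fin D) (Fin D) ℂ}
    (hA : ∀ a b, Measurable fun y => A y a b) (hB : ∀ a b, Measurable fun y => B y a b) :
    Measurable fun y => trProd (A y) (B y) := by
  simp only [trProd, Matrix.trace, Matrix.diag_apply, Matrix.mul_apply]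
  exact Complex.measurable_re.comp (Finset.measurable_fun_sum _ fun i _ =>
    Finset.measurable_fun_sum _ fun j _ => (hA i j).mul (hB j i))

theorem measurable_depolarize {Y : Type*} [MeasurableSpace Y] {A : Y → Matrix (Fin D) (Fin D) ℂ}
    (hA : ∀ a b, Measurable fun y => A y a b) (p : ℝ) (a b : Fin D) :
    Measurable fun y => depolarize p (A y) a b := by
  simp only [depolarize, Matrix.add_apply, Matrix.smul_apply, smul_eq_mul]
  exact ((hA a b).const_mul _).add_const _

end States

/-! ### Realizing the SWAP-tests by uniform thresholds. -/

section Coupling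

variable {X : Type*} {D N m : ℕ}

/-- The outcomes of the SWAP-tests on the states `σ (x i)`, realized as threshold functions of
uniform variables. -/
noncomputable def swapSample (σ : X → Matrix (Fin D) (Fin D) ℂ) (x : Fin N → X)
    (U : IndexPair N × Fin m → unitInterval) : SwapOutcomes N m :=
  fun ij k => decide ((U (ij, k) : ℝ) ≤ trProd (σ (x ij.1.1)) (σ (x ij.1.2)))

theorem volume_decide_le_eq {q : ℝ} (h0 : 0 ≤ q) (h1 : q ≤ 1) (b : Bool) :
    (volume : Measure unitInterval) {u | decide ((u : ℝ) ≤ q) = b} =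
      ENNReal.ofReal (if b then q else 1 - q) := by
  have hset : {u : unitInterval | (u : ℝ) ≤ q} = Set.Iic ⟨q, h0, h1⟩ := by
    ext u
    simp [← Subtype.coe_le_coe]
  cases b
  · have : {u : unitInterval | decide ((u : ℝ) ≤ q) = false} = {u : unitInterval | (u : ℝ) ≤ q}ᶜ := by
      ext u
      simp
    rw [this, hset, prob_compl_eq_one_sub measurableSet_Iic, unitInterval.volume_Iic]
    simp [ENNReal.ofReal_sub _ h0]
  · simp [hset, unitInterval.volume_Iic]

theorem volume_swapSample_eq {σ : X → Matrix (Fin D) (Fin D) ℂ} (hσ : ∀ x, IsDensityMatrix (σ x))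
    (x : Fin N → X) (r : SwapOutcomes N m) :
    (volume : Measure (IndexPair N × Fin m → unitInterval)) {U | swapSample σ x U = r} =
      ENNReal.ofReal (outcomeProb σ x r) := by
  have hset : {U : IndexPair N × Fin m → unitInterval | swapSample σ x U = r} =
      Set.univ.pi fun κ : IndexPair N × Fin m => {u : unitInterval | decide ((u : ℝ) ≤
        trProd (σ (x κ.1.1.1)) (σ (x κ.1.1.2))) = r κ.1 κ.2} := by
    ext U
    simp only [Set.mem_ofPred_eq, Set.mem_univ_pi, funext_iff, Prod.forall]
    rfl
  have h0 : ∀ i j, 0 ≤ trProd (σ i) (σ j) := fun i j => trProd_nonneg (hσ i).1 (hσ j).1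
  have h1 : ∀ i j, trProd (σ i) (σ j) ≤ 1 := fun i j => trProd_le_one (hσ i) (hσ j)
  rw [hset, volume_pi_pi]
  simp only [volume_decide_le_eq (h0 _ _) (h1 _ _)]
  rw [← ENNReal.ofReal_prod_of_nonneg, Fintype.prod_prod_type]
  · rfl
  · intro κ _
    split_ifs
    · exact h0 _ _
    · exact sub_nonneg.mpr (h1 _ _)

variable [MeasurableSpace X]

theorem measurable_swapSample {σ : X → Matrix (Fin D) (Fin D) ℂ}
    (hσm : ∀ a b, Measurable fun x => σ x a b) :
    Measurable fun ω : (Fin N → X) × (IndexPair N × Fin m → unitInterval) =>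
      swapSample σ ω.1 ω.2 := by
  refine measurable_pi_iff.mpr fun ij => measurable_pi_iff.mpr fun k => ?_
  refine measurable_to_bool ?_
  have hset : (fun ω : (Fin N → X) × (IndexPair N × Fin m → unitInterval) =>
      swapSample σ ω.1 ω.2 ij k) ⁻¹' {true} =
      {ω | (ω.2 (ij, k) : ℝ) ≤ trProd (σ (ω.1 ij.1.1)) (σ (ω.1 ij.1.2))} := by
    ext ω
    simp [swapSample]
  rw [hset]
  refine measurableSet_le ?_ ?_
  · exact measurable_subtype_coe.comp ((measurable_pi_apply _).comp measurable_snd)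
  · exact measurable_trProd
      (fun a b => (hσm a b).comp ((measurable_pi_apply _).comp measurable_fst))
      (fun a b => (hσm a b).comp ((measurable_pi_apply _).comp measurable_fst))

/-- By Fubini it suffices to fix the points; the sections then split over the finitely many outcome
patterns, whose probabilities are products over the independent thresholds. -/
theorem experimentLaw_eq_map (μ : Measure X) [IsProbabilityMeasure μ]
    {σ : X → Matrix (Fin D) (Fin D) ℂ} (hσ : ∀ x, IsDensityMatrix (σ x))
    (hσm : ∀ a b, Measurable fun x => σ x a b) :
    experimentLaw μ σ N m = ((Measure.pi fun _ : Fin N => μ).prod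
      (volume : Measure (IndexPair N × Fin m → unitInterval))).map
        fun ω => (ω.1, swapSample σ ω.1 ω.2) := by
  have hmeas : Measurable fun ω : (Fin N → X) × (IndexPair N × Fin m → unitInterval) =>
      (ω.1, swapSample σ ω.1 ω.2) := measurable_fst.prodMk (measurable_swapSample hσm)
  ext S hS
  have hsec : ∀ r : SwapOutcomes N m, MeasurableSet {x : Fin N → X | (x, r) ∈ S} := fun r =>
    measurable_prodMk_right hS
  rw [Measure.map_apply hmeas hS, Measure.prod_apply (hmeas hS), experimentLaw,
    Measure.finsetSum_apply]
  have hL : ∀ r : SwapOutcomes N m, (((Measure.pi fun _ : Fin N => μ).withDensity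
      fun x => ENNReal.ofReal (outcomeProb σ x r)).map fun x => (x, r)) S =
      ∫⁻ x, {x | (x, r) ∈ S}.indicator (fun x => ENNReal.ofReal (outcomeProb σ x r)) x
        ∂(Measure.pi fun _ : Fin N => μ) := fun r => by
    rw [Measure.map_apply measurable_prodMk_right hS]
    exact (withDensity_apply _ (hsec r)).trans (lintegral_indicator (hsec r) _).symm
  have hprob : ∀ r : SwapOutcomes N m, Measurable fun x : Fin N → X => outcomeProb σ x r := by
    intro r
    refine Finset.measurable_fun_prod _ fun ij _ => Finset.measurable_fun_prod _ fun k _ => ?_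
    have h := measurable_trProd (Y := Fin N → X) (A := fun x => σ (x ij.1.1))
      (B := fun x => σ (x ij.1.2)) (fun a b => (hσm a b).comp (measurable_pi_apply _))
      (fun a b => (hσm a b).comp (measurable_pi_apply _))
    unfold swapProb
    split_ifs
    · exact h
    · exact h.const_sub 1
  simp only [hL]
  rw [← lintegral_finsetSum _ fun r _ => ((hprob r).ennreal_ofReal.indicator (hsec r))]
  refine lintegral_congr fun x => ?_
  classical
  have hsplit : Prod.mk x ⁻¹' ((fun ω : (Fin N → X) × (IndexPair N × Fin m → unitInterval) =>
      (ω.1, swapSample σ ω.1 ω.2)) ⁻¹' S) =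
      ⋃ r ∈ (Finset.univ.filter fun r : SwapOutcomes N m => (x, r) ∈ S),
        {U | swapSample σ x U = r} := by
    ext U
    simp
  have hm : Measurable fun U : IndexPair N × Fin m → unitInterval => swapSample σ x U :=
    (measurable_swapSample hσm).comp measurable_prodMk_left
  rw [hsplit, measure_biUnion_finset]
  · rw [Finset.sum_filter]
    refine Finset.sum_congr rfl fun r _ => ?_
    rw [volume_swapSample_eq hσ]
    by_cases h : (x, r) ∈ S <;> simp [h]
  · intro r _ r' _ hne
    refine Set.disjoint_left.mpr fun U hU hU' => hne ?_
    exact (show swapSample σ x U = r from hU).symm.trans hU'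
  · intro r _
    exact hm (measurableSet_singleton r)

/-- Neither set needs to be measurable: the lower bound for a pushforward and the subadditivity of
the measure hold for arbitrary sets. This matters for `badKernel`, which is a union over all real
vectors. -/
theorem measure_sub_le_experimentLaw (μ : Measure X) [IsProbabilityMeasure μ]
    {σ : X → Matrix (Fin D) (Fin D) ℂ} (hσ : ∀ x, IsDensityMatrix (σ x))
    (hσm : ∀ a b, Measurable fun x => σ x a b) {δ : ℝ} (hδ : 0 ≤ δ)
    {good : Set ((Fin N → X) × SwapOutcomes N m)}
    {bad : Set ((Fin N → X) × (IndexPair N × Fin m → unitInterval))}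
    (hgood : ∀ ω, ω ∉ bad → (ω.1, swapSample σ ω.1 ω.2) ∈ good)
    (hbad : ((Measure.pi fun _ : Fin N => μ).prod volume) bad ≤ ENNReal.ofReal δ) :
    ENNReal.ofReal (1 - δ) ≤ experimentLaw μ σ N m good := by
  rw [experimentLaw_eq_map μ hσ hσm]
  have hmeas : Measurable fun ω : (Fin N → X) × (IndexPair N × Fin m → unitInterval) =>
      (ω.1, swapSample σ ω.1 ω.2) := measurable_fst.prodMk (measurable_swapSample hσm)
  refine le_trans ?_ (Measure.le_map_apply hmeas.aemeasurable _)
  refine le_trans ?_ (measure_mono (s := badᶜ) fun ω hω => hgood ω hω)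
  rw [ENNReal.ofReal_sub _ hδ, ENNReal.ofReal_one, tsub_le_iff_right]
  calc (1 : ENNReal) = ((Measure.pi fun _ : Fin N => μ).prod volume) Set.univ := by simp
    _ ≤ _ := measure_univ_le_add_compl badᶜ
    _ ≤ _ := by
      rw [compl_compl]
      gcongr

end Coupling

/-! ### Hoeffding bounds with fixed and with predictable weights. -/

section Hoeffding

variable {κ J : Type*} [Fintype κ] [Fintype J]

/-- The centred indicator of the event that a uniform variable is at most `q`. -/
noncomputable def centredBernoulli (q : ℝ) (u : unitInterval) : ℝ :=
  (if (u : ℝ) ≤ q then 1 else 0) - q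

theorem measurable_centredBernoulli (q : ℝ) : Measurable (centredBernoulli q) := by
  refine Measurable.sub_const (Measurable.ite ?_ measurable_const measurable_const) q
  exact measurableSet_le measurable_subtype_coe measurable_const

theorem integral_centredBernoulli {q : ℝ} (h0 : 0 ≤ q) (h1 : q ≤ 1) :
    ∫ u, centredBernoulli q u = 0 := by
  have hset : {u : unitInterval | (u : ℝ) ≤ q} = Set.Iic ⟨q, h0, h1⟩ := by
    ext u
    simp [← Subtype.coe_le_coe]
  have h : ∀ u : unitInterval, centredBernoulli q u =
      (Set.Iic (⟨q, h0, h1⟩ : unitInterval)).indicator (fun _ => (1 : ℝ)) u - q := fun u => by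
    rw [← hset]
    simp [centredBernoulli, Set.indicator_apply]
  simp only [h]
  rw [integral_sub ((integrable_const _).indicator measurableSet_Iic) (integrable_const _),
    integral_indicator_const _ measurableSet_Iic]
  simp [measureReal_def, unitInterval.volume_Iic, h0]

theorem hasSubgaussianMGF_centredBernoulli {q : ℝ} (h0 : 0 ≤ q) (h1 : q ≤ 1) :
    HasSubgaussianMGF (centredBernoulli q) (1 / 4) volume := by
  have h := hasSubgaussianMGF_of_mem_Icc_of_integral_eq_zero (a := -q) (b := 1 - q)
    (measurable_centredBernoulli q).aemeasurable (Filter.Eventually.of_forall fun u => by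
      unfold centredBernoulli
      split_ifs <;> constructor <;> linarith) (integral_centredBernoulli h0 h1)
  have hc : ((‖1 - q - -q‖₊ / 2) ^ 2 : NNReal) = 1 / 4 := by
    rw [show 1 - q - -q = 1 by ring]
    norm_num [div_pow]
  rwa [hc] at h

theorem hasSubgaussianMGF_sum_centredBernoulli {q : κ → ℝ} (h0 : ∀ k, 0 ≤ q k)
    (h1 : ∀ k, q k ≤ 1) {φ : J → κ} (hφ : φ.Injective) (c : J → ℝ) :
    HasSubgaussianMGF (fun U : κ → unitInterval => ∑ j, c j * centredBernoulli (q (φ j)) (U (φ j)))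
      (∑ j, ‖c j‖₊ ^ 2 * (1 / 4)) volume := by
  have hind : iIndepFun (fun k (U : κ → unitInterval) => centredBernoulli (q k) (U k)) volume :=
    iIndepFun_pi (X := fun k => centredBernoulli (q k)) fun k =>
      (measurable_centredBernoulli _).aemeasurable
  have hind' : iIndepFun (fun j (U : κ → unitInterval) =>
      c j * centredBernoulli (q (φ j)) (U (φ j))) volume :=
    (hind.precomp hφ).comp (fun j => fun z => c j * z) fun j => measurable_const_mul _
  refine HasSubgaussianMGF.sum_of_iIndepFun hind' fun j _ => ?_
  have hc : ‖c j‖₊ ^ 2 = NNReal.mk (c j ^ 2) (sq_nonneg _) := by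
    ext
    simp
  rw [hc]
  refine HasSubgaussianMGF.const_mul ?_ _
  have h := hasSubgaussianMGF_centredBernoulli (h0 (φ j)) (h1 (φ j))
  have hmap : (volume : Measure (κ → unitInterval)).map (Function.eval (φ j)) = volume :=
    (measurePreserving_eval (fun _ : κ => (volume : Measure unitInterval)) (φ j)).map_eq
  have hm : AEMeasurable (Function.eval (φ j)) (volume : Measure (κ → unitInterval)) :=
    (measurable_pi_apply _).aemeasurable
  rw [← hmap] at h
  exact h.of_map hm

/-- Each summand is sub-Gaussian with parameter c²/4, so with V = Σc² and ε² = sV the exponent is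
ε²/(2·V/4) = 2s. The strict inequality makes the event empty when V = 0. -/
theorem volume_sq_sum_centredBernoulli_le {q : κ → ℝ} (h0 : ∀ k, 0 ≤ q k)
    (h1 : ∀ k, q k ≤ 1) {φ : J → κ} (hφ : φ.Injective) (c : J → ℝ) (s : ℝ) :
    (volume : Measure (κ → unitInterval)) {U | s * ∑ j, c j ^ 2 <
      (∑ j, c j * centredBernoulli (q (φ j)) (U (φ j))) ^ 2} ≤
      ENNReal.ofReal (2 * Real.exp (-(2 * s))) := by
  by_cases hs : s < 0
  · refine prob_le_one.trans ?_
    rw [← ENNReal.ofReal_one]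
    refine ENNReal.ofReal_le_ofReal ?_
    have := Real.one_le_exp (show 0 ≤ -(2 * s) by linarith)
    linarith
  push Not at hs
  have hS := hasSubgaussianMGF_sum_centredBernoulli h0 h1 hφ c
  set Z : (κ → unitInterval) → ℝ := fun U => ∑ j, c j * centredBernoulli (q (φ j)) (U (φ j))
  set V := ∑ j, c j ^ 2 with hV
  have hVc : ((∑ j, ‖c j‖₊ ^ 2 * (1 / 4) : NNReal) : ℝ) = V / 4 := by
    push_cast
    rw [← Finset.sum_mul]
    simp [hV]
    ring
  have hV0 : 0 ≤ V := Finset.sum_nonneg fun j _ => sq_nonneg _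
  rcases hV0.eq_or_lt with hVz | hVp
  · have hc : ∀ j, c j = 0 := fun j => by
      have := (Finset.sum_eq_zero_iff_of_nonneg fun j _ => sq_nonneg (c j)).mp hVz.symm j
        (Finset.mem_univ j)
      exact pow_eq_zero_iff two_ne_zero |>.mp this
    have : {U : κ → unitInterval | s * V < Z U ^ 2} = ∅ := by
      ext U
      simp [Z, hc, ← hVz]
    rw [this, measure_empty]
    exact zero_le
  · set ε := Real.sqrt (s * V) with hε
    have hεsq : ε ^ 2 = s * V := Real.sq_sqrt (by positivity)
    have hexp : -ε ^ 2 / (2 * (V / 4)) = -(2 * s) := by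
      rw [hεsq]
      field_simp
      ring
    have hup := hS.measure_ge_le (Real.sqrt_nonneg (s * V))
    have hdown := hS.neg.measure_ge_le (Real.sqrt_nonneg (s * V))
    rw [← hε, hVc, hexp] at hup hdown
    have hsub : {U : κ → unitInterval | s * V < Z U ^ 2} ⊆
        {U | ε ≤ Z U} ∪ {U | ε ≤ (-Z) U} := by
      intro U hU
      have : ε < |Z U| := by
        refine lt_of_pow_lt_pow_left₀ 2 (abs_nonneg _) ?_
        rw [hεsq, sq_abs]
        exact hU
      rcases lt_abs.mp this with h | h
      · exact Or.inl h.le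
      · exact Or.inr h.le
    have h := (measureReal_mono hsub).trans ((measureReal_union_le _ _).trans (add_le_add hup hdown))
    rw [← two_mul] at h
    rw [measureReal_def] at h
    exact (ENNReal.le_ofReal_iff_toReal_le (measure_ne_top _ _) (by positivity)).mpr h

/-- The tail bound for weights which are random, but depend only on coordinates that do not occur
in the sum. -/
theorem volume_sq_sum_predictable_le {q : κ → ℝ} (h0 : ∀ k, 0 ≤ q k)
    (h1 : ∀ k, q k ≤ 1) {φ : J → κ} (hφ : φ.Injective) {c : (κ → unitInterval) → J → ℝ}
    (hcm : Measurable c) (hc : ∀ U U', (∀ k ∉ Set.range φ, U k = U' k) → c U = c U') (s : ℝ) :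
    (volume : Measure (κ → unitInterval)) {U | s * ∑ j, c U j ^ 2 <
      (∑ j, c U j * centredBernoulli (q (φ j)) (U (φ j))) ^ 2} ≤
      ENNReal.ofReal (2 * Real.exp (-(2 * s))) := by
  classical
  have hmp := (volume_preserving_piEquivPiSubtypeProd (fun _ : κ => unitInterval)
    (fun k => ∃ j, φ j = k)).symm
  have hcj : ∀ j, Measurable fun U => c U j := fun j => (measurable_pi_apply j).comp hcm
  have hmeas : MeasurableSet {U : κ → unitInterval | s * ∑ j, c U j ^ 2 <
      (∑ j, c U j * centredBernoulli (q (φ j)) (U (φ j))) ^ 2} := by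
    refine measurableSet_lt ?_ ?_
    · exact (Finset.measurable_fun_sum _ fun j _ => (hcj j).pow_const 2).const_mul s
    · exact (Finset.measurable_fun_sum _ fun j _ => (hcj j).mul
        ((measurable_centredBernoulli _).comp (measurable_pi_apply _))).pow_const 2
  -- The cube splits into the coordinates that occur in the sum and the rest. With the rest frozen
  -- the weights are constant, and the bound for fixed weights applies in every section.
  rw [← hmp.measure_preimage hmeas.nullMeasurableSet, Measure.volume_eq_prod,
    Measure.prod_apply_symm (hmp.measurable hmeas)]
  refine (lintegral_mono (g := fun _ => ENNReal.ofReal (2 * Real.exp (-(2 * s)))) fun V => ?_).trans_eq ?_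
  · let e := (MeasurableEquiv.piEquivPiSubtypeProd (fun _ : κ => unitInterval)
      (fun k => ∃ j, φ j = k)).symm
    have hin : ∀ W j, e (W, V) (φ j) = W ⟨φ j, j, rfl⟩ := fun W j => by
      simp [e, MeasurableEquiv.piEquivPiSubtypeProd, Equiv.piEquivPiSubtypeProd]
    have hout : ∀ W W', c (e (W, V)) = c (e (W', V)) := fun W W' => hc _ _ fun k hk => by
      simp only [Set.mem_range, not_exists] at hk
      simp [e, MeasurableEquiv.piEquivPiSubtypeProd, Equiv.piEquivPiSubtypeProd, hk]
    have hφ' : (fun j => (⟨φ j, j, rfl⟩ : {k // ∃ j, φ j = k})).Injective := fun i j h =>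
      hφ (congrArg Subtype.val h)
    have h := volume_sq_sum_centredBernoulli_le (q := fun k : {k // ∃ j, φ j = k} => q k)
      (fun k => h0 k) (fun k => h1 k) hφ' (c (e (fun _ => 0, V))) s
    refine le_trans (le_of_eq (congrArg _ (Set.ext fun W => ?_))) h
    change s * ∑ j, c (e (W, V)) j ^ 2 < (∑ j, c (e (W, V)) j *
      centredBernoulli (q (φ j)) (e (W, V) (φ j))) ^ 2 ↔ _
    simp only [hin, hout W fun _ => 0]
    exact Iff.rfl
  · simp

end Hoeffding

/-! ### Nets in the ball of radius 2 and norms of bilinear forms. -/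

section Net

variable {E : Type*} [NormedAddCommGroup E] [NormedSpace ℝ E]

/-- A 1-separated subset of maximal cardinality is a net. The Besicovitch volume bound shows that
the maximum exists and is at most 5^dim. -/
theorem exists_finset_norm_sub_le_one [FiniteDimensional ℝ E] : ∃ T : Finset E, T.card ≤ 5 ^ Module.finrank ℝ E ∧
    (∀ v ∈ T, ‖v‖ ≤ 2) ∧ ∀ u : E, ‖u‖ ≤ 2 → ∃ v ∈ T, ‖u - v‖ ≤ 1 := by
  classical
  let P : ℕ → Prop := fun n => ∃ T : Finset E, T.card = n ∧ (∀ v ∈ T, ‖v‖ ≤ 2) ∧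
    ∀ u ∈ T, ∀ v ∈ T, u ≠ v → 1 ≤ ‖u - v‖
  have hb : ∀ n, P n → n ≤ 5 ^ Module.finrank ℝ E := by
    rintro n ⟨T, rfl, h1, h2⟩
    exact Besicovitch.card_le_of_separated T h1 h2
  have hP0 : P 0 := ⟨∅, by simp⟩
  obtain ⟨T, hT, hT1, hT2⟩ := Nat.findGreatest_spec (P := P) (Nat.zero_le _) hP0
  refine ⟨T, hT.trans_le (Nat.findGreatest_le _), hT1, fun u hu => ?_⟩
  by_contra! hfar
  have huT : u ∉ T := fun h => by
    have := hfar u h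
    simp at this
    linarith
  have hP : P (T.card + 1) := by
    refine ⟨insert u T, Finset.card_insert_of_notMem huT, ?_, ?_⟩
    · simpa [hu] using hT1
    · intro a ha b hb hab
      rcases Finset.mem_insert.mp ha with rfl | ha' <;> rcases Finset.mem_insert.mp hb with rfl | hb'
      · exact absurd rfl hab
      · exact (hfar b hb').le
      · rw [norm_sub_rev]
        exact (hfar a ha').le
      · exact hT2 a ha' b hb' hab
  have := Nat.le_findGreatest (hb _ hP) hP
  omega

/-- On the ball of radius 2 the net gives 2‖l‖ ≤ t + ‖l‖, hence ‖l‖ ≤ t: radius 2 with mesh 1 costs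
no extra constant. -/
theorem norm_apply_le_of_net {T : Finset E} (hT : ∀ u : E, ‖u‖ ≤ 2 → ∃ v ∈ T, ‖u - v‖ ≤ 1)
    (l : E →L[ℝ] ℝ) {t : ℝ} (ht : 0 ≤ t) (hl : ∀ v ∈ T, |l v| ≤ t) (u : E) : |l u| ≤ t * ‖u‖ := by
  have h2 : ∀ u : E, ‖u‖ ≤ 2 → |l u| ≤ t + ‖l‖ := fun u hu => by
    obtain ⟨v, hv, huv⟩ := hT u hu
    have e : l u = l v + l (u - v) := by simp
    rw [e]
    refine (abs_add_le _ _).trans (add_le_add (hl v hv) ?_)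
    exact (l.le_opNorm _).trans (mul_le_of_le_one_right (norm_nonneg _) huv)
  have h3 : ‖l‖ ≤ (t + ‖l‖) / 2 := by
    refine l.opNorm_le_bound (by positivity) fun u => ?_
    rcases eq_or_ne u 0 with rfl | hu
    · simp
    have hu' : 0 < ‖u‖ := norm_pos_iff.mpr hu
    have h := h2 ((2 / ‖u‖) • u) (by rw [norm_smul, Real.norm_of_nonneg (by positivity)]; field_simp; exact le_rfl)
    rw [map_smul, smul_eq_mul, abs_mul, abs_of_pos (by positivity : 0 < 2 / ‖u‖), div_mul_eq_mul_div,
      div_le_iff₀ hu'] at h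
    rw [Real.norm_eq_abs]
    linarith
  have h4 : ‖l‖ ≤ t := by linarith
  exact (l.le_opNorm u).trans (by gcongr)

theorem bilinear_le_of_net [FiniteDimensional ℝ E] {T : Finset E} (hT : ∀ u : E, ‖u‖ ≤ 2 → ∃ v ∈ T, ‖u - v‖ ≤ 1)
    (B : E →ₗ[ℝ] E →ₗ[ℝ] ℝ) {t : ℝ} (ht : 0 ≤ t) (hB : ∀ u ∈ T, ∀ v ∈ T, |B u v| ≤ t) (u v : E) :
    |B u v| ≤ t * ‖u‖ * ‖v‖ := by
  have h1 : ∀ v ∈ T, ∀ u, |B u v| ≤ t * ‖u‖ := fun v hv u =>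
    norm_apply_le_of_net hT (LinearMap.toContinuousLinearMap (B.flip v)) ht
      (fun u hu => hB u hu v hv) u
  exact norm_apply_le_of_net hT (LinearMap.toContinuousLinearMap (B u)) (by positivity)
    (fun v hv => h1 v hv u) v

end Net

/-! ### Azuma's inequality for predictable losses. -/

section Azuma

variable {X : Type*} [MeasurableSpace X] (μ : Measure X) [IsProbabilityMeasure μ]

/-- The excess of the expected over the observed losses, when the `t`-th loss function is
determined by the first `t` points and is evaluated at the next one. -/
noncomputable def lossExcess (l : (n : ℕ) → (Fin n → X) → X → ℝ) (n : ℕ) (x : Fin n → X) : ℝ :=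
  ∑ t : Fin n, (∫ z, l t (initialSegment x t.2.le) z ∂μ - l t (initialSegment x t.2.le) (x t))

theorem measurable_initialSegment {n t : ℕ} (ht : t ≤ n) :
    Measurable fun x : Fin n → X => initialSegment x ht :=
  measurable_pi_iff.mpr fun _ => measurable_pi_apply _

variable {l : (n : ℕ) → (Fin n → X) → X → ℝ} (hl : ∀ n, Measurable (Function.uncurry (l n)))
  (hl0 : ∀ n x z, l n x z ∈ Set.Icc (0 : ℝ) 2)

include hl in
theorem measurable_lossExcess (n : ℕ) : Measurable (lossExcess μ l n) := by
  refine Finset.measurable_fun_sum _ fun t _ => Measurable.sub ?_ ?_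
  · exact ((hl t).stronglyMeasurable.integral_prod_right (ν := μ)).measurable.comp
      (measurable_initialSegment _)
  · exact (hl t).comp ((measurable_initialSegment _).prodMk (measurable_pi_apply t))

include hl hl0 in
-- Hoeffding's lemma for a variable with values in an interval of length 2, hence with sub-Gaussian
-- parameter 1.
theorem lintegral_exp_loss_le (n : ℕ) (x : Fin n → X) (θ : ℝ) :
    ∫⁻ z, ENNReal.ofReal (Real.exp (θ * (∫ z', l n x z' ∂μ - l n x z))) ∂μ ≤
      ENNReal.ofReal (Real.exp (θ ^ 2 / 2)) := by
  have hm : Measurable (l n x) := (hl n).comp measurable_prodMk_left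
  have h := (hasSubgaussianMGF_of_mem_Icc (μ := μ) (a := 0) (b := 2) hm.aemeasurable
    (Filter.Eventually.of_forall fun z => hl0 n x z)).neg
  have hc : ((‖(2 : ℝ) - 0‖₊ / 2) ^ 2 : NNReal) = 1 := by
    rw [sub_zero]
    norm_num
  rw [hc] at h
  have h1 := h.mgf_le θ
  have h2 := h.integrable_exp_mul θ
  simp only [Pi.neg_apply, neg_sub] at h2
  rw [← ofReal_integral_eq_lintegral_ofReal h2 (Filter.Eventually.of_forall fun _ =>
    (Real.exp_pos _).le)]
  refine ENNReal.ofReal_le_ofReal ?_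
  simpa [mgf] using h1

include hl hl0 in
-- The last point is integrated out first: the earlier terms do not depend on it, and each point
-- contributes a factor exp(θ²/2).
theorem lintegral_exp_lossExcess_le (θ : ℝ) (n : ℕ) :
    ∫⁻ x, ENNReal.ofReal (Real.exp (θ * lossExcess μ l n x)) ∂(Measure.pi fun _ : Fin n => μ) ≤
      ENNReal.ofReal (Real.exp (n * (θ ^ 2 / 2))) := by
  induction n with
  | zero => simp [lossExcess]
  | succ n ih =>
    have hmp := (measurePreserving_piFinSuccAbove (fun _ : Fin (n + 1) => μ) (Fin.last n)).symm
    have hmeas : ∀ n, Measurable fun x : Fin n → X =>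
        ENNReal.ofReal (Real.exp (θ * lossExcess μ l n x)) := fun n =>
      (Real.measurable_exp.comp ((measurable_lossExcess μ hl n).const_mul θ)).ennreal_ofReal
    have hsum : ∀ (z : X) (x : Fin n → X), lossExcess μ l (n + 1)
        ((MeasurableEquiv.piFinSuccAbove (fun _ => X) (Fin.last n)).symm (z, x)) =
        lossExcess μ l n x + (∫ z', l n x z' ∂μ - l n x z) := fun z x => by
      have hx : (MeasurableEquiv.piFinSuccAbove (fun _ => X) (Fin.last n)).symm (z, x) =
          Fin.snoc x z := by
        ext i
        simp [MeasurableEquiv.piFinSuccAbove, Fin.insertNthEquiv, Fin.insertNth_last']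
      rw [hx, lossExcess, Fin.sum_univ_castSucc]
      have hseg : ∀ (t : ℕ) (ht : t ≤ n) (ht' : t ≤ n + 1),
          initialSegment (Fin.snoc x z : Fin (n + 1) → X) ht' = initialSegment x ht := by
        intro t ht ht'
        ext i
        exact Fin.snoc_castSucc (α := fun _ => X) z x (Fin.castLE ht i)
      congr 1
      · refine Finset.sum_congr rfl fun t _ => ?_
        simp only [Fin.val_castSucc, Fin.snoc_castSucc]
        rw [hseg t t.2.le]
      · have : initialSegment (Fin.snoc x z : Fin (n + 1) → X) (Fin.last n).2.le = x :=
          hseg n le_rfl _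
        simp only [Fin.snoc_last]
        rw [this]
        rfl
    have hm2 : Measurable fun a => ENNReal.ofReal (Real.exp (θ * lossExcess μ l (n + 1)
        ((MeasurableEquiv.piFinSuccAbove (fun _ => X) (Fin.last n)).symm a))) :=
      (hmeas (n + 1)).comp hmp.measurable
    rw [← hmp.lintegral_comp (hmeas (n + 1)), lintegral_prod_symm _ hm2.aemeasurable]
    calc _ ≤ ∫⁻ x, ENNReal.ofReal (Real.exp (θ * lossExcess μ l n x)) *
          ENNReal.ofReal (Real.exp (θ ^ 2 / 2)) ∂(Measure.pi fun _ : Fin n => μ) := by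
          refine lintegral_mono fun x => ?_
          refine le_trans (le_of_eq ?_)
            (mul_le_mul_right (lintegral_exp_loss_le μ hl hl0 n x θ) _)
          rw [← lintegral_const_mul']
          · refine lintegral_congr fun z => ?_
            rw [hsum, ← ENNReal.ofReal_mul (Real.exp_pos _).le, ← Real.exp_add, mul_add]
          · exact ENNReal.ofReal_ne_top
      _ ≤ ENNReal.ofReal (Real.exp (n * (θ ^ 2 / 2))) * ENNReal.ofReal (Real.exp (θ ^ 2 / 2)) := by
          rw [lintegral_mul_const _ (hmeas n)]
          gcongr
      _ = _ := by
          rw [← ENNReal.ofReal_mul (Real.exp_pos _).le, ← Real.exp_add]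
          push_cast
          ring_nf

include hl hl0 in
theorem measure_lossExcess_ge_le {n : ℕ} (hn : 0 < n) {ε : ℝ} (hε : 0 ≤ ε) :
    (Measure.pi fun _ : Fin n => μ) {x | ε ≤ lossExcess μ l n x} ≤
      ENNReal.ofReal (Real.exp (-(ε ^ 2 / (2 * n)))) := by
  have hn' : (0 : ℝ) < n := by exact_mod_cast hn
  -- This minimizes the Chernoff exponent nθ²/2 - θε.
  set θ := ε / n with hθ
  have hmeas : Measurable fun x : Fin n → X =>
      ENNReal.ofReal (Real.exp (θ * lossExcess μ l n x)) :=
    (Real.measurable_exp.comp ((measurable_lossExcess μ hl n).const_mul θ)).ennreal_ofReal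
  have h := (mul_meas_ge_le_lintegral hmeas (ENNReal.ofReal (Real.exp (θ * ε)))
    (μ := Measure.pi fun _ : Fin n => μ)).trans (lintegral_exp_lossExcess_le μ hl hl0 θ n)
  have hsub : {x : Fin n → X | ε ≤ lossExcess μ l n x} ⊆ {x | ENNReal.ofReal (Real.exp (θ * ε)) ≤
      ENNReal.ofReal (Real.exp (θ * lossExcess μ l n x))} := fun x hx => by
    refine ENNReal.ofReal_le_ofReal (Real.exp_le_exp.mpr ?_)
    exact mul_le_mul_of_nonneg_left hx (by positivity)
  have h' := (mul_le_mul_right (measure_mono hsub) _).trans h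
  rw [mul_comm, ← ENNReal.le_div_iff_mul_le (by simp [Real.exp_pos]) (by simp),
    ← ENNReal.ofReal_div_of_pos (Real.exp_pos _), ← Real.exp_sub] at h'
  refine h'.trans_eq ?_
  congr 2
  rw [hθ]
  field_simp
  ring

end Azuma

/-! ### The learning rule and its measurability. -/

section Learner

/-- Truncation to the interval `[-1, 1]`. -/
def clip (r : ℝ) : ℝ := max (-1) (min 1 r)

theorem abs_clip_le_one (r : ℝ) : |clip r| ≤ 1 :=
  abs_le.mpr ⟨le_max_left _ _, max_le (by norm_num) (min_le_left _ _)⟩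

/-- Clipping makes the losses bounded, as Azuma requires, without increasing the error for targets
in [-1, 1]. -/
theorem abs_clip_sub_le {r s : ℝ} (hs : |s| ≤ 1) : |clip r - s| ≤ |r - s| := by
  have h := abs_le.mp hs
  unfold clip
  rcases le_total 1 r with h1 | h1
  · rw [min_eq_left h1, max_eq_right (by norm_num), abs_of_nonneg (by linarith),
      abs_of_nonneg (by linarith)]
    linarith
  · rw [min_eq_right h1]
    rcases le_total (-1) r with h2 | h2
    · rw [max_eq_right h2]
    · rw [max_eq_left h2, abs_of_nonpos (by linarith), abs_of_nonpos (by linarith)]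
      linarith

theorem measurable_clip : Measurable clip :=
  measurable_const.max (measurable_const.min measurable_id)

/-- The truncated prediction of kernel ridge regression. -/
noncomputable def ridgePrediction {n : ℕ} (lam : ℝ) (y : Fin n → ℝ) (K : Fin n → Fin n → ℝ)
    (k : Fin n → ℝ) : ℝ :=
  clip (∑ i, ridgeWeights lam y K i * k i)

/-- The average of the truncated predictions of kernel ridge regression trained on the first
`t` data points, `t = 0, …, N - 1`. -/
noncomputable def onlineRidge : KernelLearner := fun N lam y K k =>
  (∑ t : Fin N, ridgePrediction lam (initialSegment y t.2.le) (leadingBlock K t.2.le)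
    (initialSegment k t.2.le)) / N

variable {Ω : Type*} [MeasurableSpace Ω]

/-- The inverse is the adjugate times the inverted determinant; real inversion is measurable also at
0, so singular inputs need no separate treatment. -/
theorem measurable_ridgeWeights {n : ℕ} (lam : ℝ) {y : Ω → Fin n → ℝ} {K : Ω → Fin n → Fin n → ℝ}
    (hy : Measurable y) (hK : Measurable K) :
    Measurable fun ω => ridgeWeights lam (y ω) (K ω) := by
  have hcont : Continuous fun K : Fin n → Fin n → ℝ =>
      Matrix.of K + (5 * lam) • (1 : Matrix (Fin n) (Fin n) ℝ) :=
    (continuous_id.add continuous_const :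
      Continuous fun K : Matrix (Fin n) (Fin n) ℝ => K + (5 * lam) • (1 : Matrix (Fin n) (Fin n) ℝ))
  have hdet := (hcont.matrix_det).measurable.comp hK
  have hadj : ∀ i j, Measurable fun ω =>
      (Matrix.of (K ω) + (5 * lam) • (1 : Matrix (Fin n) (Fin n) ℝ)).adjugate i j := fun i j =>
    (hcont.matrix_adjugate.matrix_elem i j).measurable.comp hK
  refine measurable_pi_iff.mpr fun i => ?_
  simp only [ridgeWeights, Matrix.inv_def, Ring.inverse_eq_inv', Matrix.mulVec, dotProduct,
    Matrix.smul_apply, smul_eq_mul]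
  exact Finset.measurable_fun_sum _ fun j _ =>
    ((hdet.inv).mul (hadj i j)).mul ((measurable_pi_apply j).comp hy)

theorem measurable_ridgePrediction {n : ℕ} (lam : ℝ) {y k : Ω → Fin n → ℝ}
    {K : Ω → Fin n → Fin n → ℝ} (hy : Measurable y) (hK : Measurable K) (hk : Measurable k) :
    Measurable fun ω => ridgePrediction lam (y ω) (K ω) (k ω) :=
  measurable_clip.comp (Finset.measurable_fun_sum _ fun i _ =>
    ((measurable_pi_apply i).comp (measurable_ridgeWeights lam hy hK)).mul
      ((measurable_pi_apply i).comp hk))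

theorem measurable_leadingBlock {n t : ℕ} (ht : t ≤ n) :
    Measurable fun K : Fin n → Fin n → ℝ => leadingBlock K ht :=
  measurable_pi_iff.mpr fun _ => measurable_pi_iff.mpr fun _ =>
    (measurable_pi_apply _).comp (measurable_pi_apply _)

theorem onlineRidge_isMeasurable : onlineRidge.IsMeasurable := by
  intro N lam
  refine Measurable.div_const (Finset.measurable_fun_sum _ fun t _ => ?_) _
  exact measurable_ridgePrediction lam
    ((measurable_initialSegment _).comp measurable_fst)
    ((measurable_leadingBlock _).comp (measurable_fst.comp measurable_snd))
    ((measurable_initialSegment _).comp (measurable_snd.comp measurable_snd))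

end Learner

/-! ### Kernel estimates and losses as functions of points and thresholds. -/

section Threshold

variable {X : Type*} {N m n : ℕ}

/-- The kernel estimate obtained from the thresholds `V i j k`, `i ≤ j`, `k < m`. -/
noncomputable def thresholdKernel (V : ℕ → ℕ → Fin m → unitInterval) (q : X → X → ℝ)
    (x : Fin n → X) : Fin n → Fin n → ℝ :=
  fun i j => (∑ k, if (V (min i j : Fin n) (max i j : Fin n) k : ℝ) ≤ q (x (min i j)) (x (max i j))
    then (1 : ℝ) else 0) / m

/-- A family of thresholds for the pairs of indices below `N`, extended by zero. -/
def extendThresholds (U : IndexPair N × Fin m → unitInterval) : ℕ → ℕ → Fin m → unitInterval :=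
  fun i j k => if h : i ≤ j ∧ j < N then
    U (⟨(⟨i, h.1.trans_lt h.2⟩, ⟨j, h.2⟩), h.1⟩, k) else 0

theorem extendThresholds_apply (U : IndexPair N × Fin m → unitInterval) (ij : IndexPair N)
    (k : Fin m) : extendThresholds U ij.1.1 ij.1.2 k = U (ij, k) := by
  have h : (ij.1.1 : ℕ) ≤ ij.1.2 ∧ (ij.1.2 : ℕ) < N := ⟨ij.2, ij.1.2.2⟩
  simp [extendThresholds, h]

theorem estimatedKernel_swapSample {D : ℕ} (σ : X → Matrix (Fin D) (Fin D) ℂ) (x : Fin N → X)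
    (U : IndexPair N × Fin m → unitInterval) : estimatedKernel (swapSample σ x U) =
      Matrix.of (thresholdKernel (extendThresholds U) (fun a b => trProd (σ a) (σ b)) x) := by
  ext i j
  have h := fun k => extendThresholds_apply U ⟨(min i j, max i j), min_le_max⟩ k
  simp only at h
  simp only [estimatedKernel, swapSample, thresholdKernel, Matrix.of_apply, h, decide_eq_true_eq]

/-- Thresholds are indexed by natural numbers so that one family serves every sample size.
Truncating the estimate then equals estimating from the truncated sample, so the t-th loss is a
function of the first t points. -/
theorem leadingBlock_thresholdKernel (V : ℕ → ℕ → Fin m → unitInterval) (q : X → X → ℝ)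
    (x : Fin n → X) {t : ℕ} (ht : t ≤ n) :
    leadingBlock (thresholdKernel V q x) ht = thresholdKernel V q (initialSegment x ht) := by
  ext i j
  have h := (Fin.strictMono_castLE ht).monotone
  simp only [leadingBlock, thresholdKernel, initialSegment, ← h.map_min, ← h.map_max,
    Fin.val_castLE]
  rfl

theorem thresholdKernel_comm (V : ℕ → ℕ → Fin m → unitInterval) (q : X → X → ℝ)
    (x : Fin n → X) (i j : Fin n) : thresholdKernel V q x i j = thresholdKernel V q x j i := by
  simp only [thresholdKernel, min_comm i j, max_comm i j]

theorem thresholdKernel_le_one (V : ℕ → ℕ → Fin m → unitInterval) (q : X → X → ℝ)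
    (x : Fin n → X) (i j : Fin n) : thresholdKernel V q x i j ≤ 1 := by
  refine div_le_one_of_le₀ ?_ (Nat.cast_nonneg m)
  refine (Finset.sum_le_card_nsmul _ _ 1 fun k _ => ?_).trans (by simp)
  split_ifs <;> norm_num

theorem thresholdKernel_sub (hm : 0 < m) (U : IndexPair N × Fin m → unitInterval)
    (q : X → X → ℝ) (x : Fin N → X) (i j : Fin N) :
    thresholdKernel (extendThresholds U) q x i j - q (x (min i j)) (x (max i j)) =
      (∑ k, centredBernoulli (q (x (min i j)) (x (max i j)))
        (U (⟨(min i j, max i j), min_le_max⟩, k))) / m := by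
  have h := fun k => extendThresholds_apply U ⟨(min i j, max i j), min_le_max⟩ k
  simp only at h
  have hm' : (m : ℝ) ≠ 0 := by positivity
  simp only [thresholdKernel, h, centredBernoulli, Finset.sum_sub_distrib]
  rw [sub_div]
  congr 1
  simp
  field_simp

variable [MeasurableSpace X] {Ω : Type*} [MeasurableSpace Ω]

theorem measurable_thresholdKernel {q : X → X → ℝ} (hq : Measurable (Function.uncurry q))
    {V : Ω → ℕ → ℕ → Fin m → unitInterval} (hV : ∀ i j k, Measurable fun ω => V ω i j k)
    {x : Ω → Fin n → X} (hx : Measurable x) :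
    Measurable fun ω => thresholdKernel (V ω) q (x ω) := by
  refine measurable_pi_iff.mpr fun i => measurable_pi_iff.mpr fun j =>
    Measurable.div_const (Finset.measurable_fun_sum _ fun k _ =>
      Measurable.ite ?_ measurable_const measurable_const) _
  refine measurableSet_le (measurable_subtype_coe.comp (hV _ _ _)) ?_
  exact hq.comp (((measurable_pi_apply _).comp hx).prodMk ((measurable_pi_apply _).comp hx))

theorem measurable_extendThresholds (i j : ℕ) (k : Fin m) :
    Measurable fun U : IndexPair N × Fin m → unitInterval => extendThresholds U i j k := by
  unfold extendThresholds
  split_ifs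
  · exact measurable_pi_apply _
  · exact measurable_const

/-- The loss at `z` of kernel ridge regression trained on the points `x`. -/
noncomputable def ridgeLoss (lam : ℝ) (f : X → ℝ) (q : X → X → ℝ)
    (V : ℕ → ℕ → Fin m → unitInterval) (n : ℕ) (x : Fin n → X) (z : X) : ℝ :=
  |ridgePrediction lam (fun i => f (x i)) (thresholdKernel V q x) (fun i => q (x i) z) - f z|

theorem measurable_ridgeLoss (lam : ℝ) {f : X → ℝ} (hf : Measurable f) {q : X → X → ℝ}
    (hq : Measurable (Function.uncurry q)) {V : Ω → ℕ → ℕ → Fin m → unitInterval}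
    (hV : ∀ i j k, Measurable fun ω => V ω i j k) {x : Ω → Fin n → X} (hx : Measurable x)
    {z : Ω → X} (hz : Measurable z) :
    Measurable fun ω => ridgeLoss lam f q (V ω) n (x ω) (z ω) := by
  have hxi : ∀ i, Measurable fun ω => x ω i := fun i => (measurable_pi_apply i).comp hx
  refine ((measurable_ridgePrediction lam ?_ (measurable_thresholdKernel hq hV hx) ?_).sub
    (hf.comp hz)).abs
  · exact measurable_pi_iff.mpr fun i => hf.comp (hxi i)
  · exact measurable_pi_iff.mpr fun i => hq.comp ((hxi i).prodMk hz)

omit [MeasurableSpace X] in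
theorem ridgeLoss_mem_Icc (lam : ℝ) {f : X → ℝ} (hf : ∀ z, |f z| ≤ 1) (q : X → X → ℝ)
    (V : ℕ → ℕ → Fin m → unitInterval) (n : ℕ) (x : Fin n → X) (z : X) :
    ridgeLoss lam f q V n x z ∈ Set.Icc (0 : ℝ) 2 := by
  refine ⟨abs_nonneg _, (abs_sub _ _).trans ?_⟩
  have := abs_clip_le_one (∑ i, ridgeWeights lam (fun i => f (x i)) (thresholdKernel V q x) i *
    q (x i) z)
  have h2 := hf z
  unfold ridgePrediction
  linarith

theorem measurable_lossExcess_ridgeLoss (μ : Measure X) [IsProbabilityMeasure μ] (lam : ℝ)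
    {f : X → ℝ} (hf : Measurable f) {q : X → X → ℝ} (hq : Measurable (Function.uncurry q)) :
    Measurable fun ω : (Fin N → X) × (IndexPair N × Fin m → unitInterval) =>
      lossExcess μ (ridgeLoss lam f q (extendThresholds ω.2)) N ω.1 := by
  have hU : ∀ i j k, Measurable fun ω : (Fin N → X) × (IndexPair N × Fin m → unitInterval) =>
      extendThresholds ω.2 i j k := fun i j k =>
    (measurable_extendThresholds i j k).comp measurable_snd
  refine Finset.measurable_fun_sum _ fun t _ => Measurable.sub ?_ ?_
  · have h := measurable_ridgeLoss (Ω := ((Fin N → X) × (IndexPair N × Fin m → unitInterval)) × X)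
      lam hf hq (fun i j k => (hU i j k).comp measurable_fst)
      ((measurable_initialSegment t.2.le).comp (measurable_fst.comp measurable_fst)) measurable_snd
    exact (h.stronglyMeasurable.integral_prod_right (ν := μ)).measurable
  · exact measurable_ridgeLoss lam hf hq hU ((measurable_initialSegment t.2.le).comp measurable_fst)
      ((measurable_pi_apply t).comp measurable_fst)

end Threshold

/-! ### Product measures bounded through sections. -/

section Sections

variable {α β : Type*} [MeasurableSpace α] [MeasurableSpace β] {μ : Measure α} {ν : Measure β}

theorem prod_le_of_forall_left [IsProbabilityMeasure μ] [SFinite ν] {S : Set (α × β)}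
    (hS : MeasurableSet S) {c : ENNReal} (h : ∀ a, ν {b | (a, b) ∈ S} ≤ c) : (μ.prod ν) S ≤ c := by
  rw [Measure.prod_apply hS]
  exact (lintegral_mono fun a => h a).trans_eq (by simp)

theorem prod_le_of_forall_right [SFinite μ] [IsProbabilityMeasure ν] {S : Set (α × β)}
    (hS : MeasurableSet S) {c : ENNReal} (h : ∀ b, μ {a | (a, b) ∈ S} ≤ c) : (μ.prod ν) S ≤ c := by
  rw [Measure.prod_apply_symm hS]
  exact (lintegral_mono fun b => h b).trans_eq (by simp)

end Sections

/-! ### Bilinear forms of symmetric matrices as sums over unordered pairs. -/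

section Pairs

variable {N : ℕ}

/-- The unordered pair of the indices `i` and `j`. -/
def indexPair (ij : Fin N × Fin N) : IndexPair N := ⟨(min ij.1 ij.2, max ij.1 ij.2), min_le_max⟩

/-- The coefficient of a symmetric matrix entry in the bilinear form with arguments `u`, `v`. -/
def pairCoeff (u v : Fin N → ℝ) (p : IndexPair N) : ℝ :=
  ∑ ij : Fin N × Fin N with indexPair ij = p, u ij.1 * v ij.2

theorem sum_pairCoeff_mul (u v : Fin N → ℝ) (g : IndexPair N → ℝ) :
    ∑ p, pairCoeff u v p * g p = ∑ i, ∑ j, u i * v j * g (indexPair (i, j)) := by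
  rw [← Fintype.sum_prod_type' (f := fun i j => u i * v j * g (indexPair (i, j))),
    ← Finset.sum_fiberwise Finset.univ indexPair]
  refine Finset.sum_congr rfl fun p _ => ?_
  rw [pairCoeff, Finset.sum_mul]
  refine Finset.sum_congr rfl fun ij hij => ?_
  rw [(Finset.mem_filter.mp hij).2]

/-- The same test average fills the entries (i, j) and (j, i), so a pair collects at most two terms;
Cauchy-Schwarz on each fibre costs the factor 2. -/
theorem sum_pairCoeff_sq_le (u v : Fin N → ℝ) :
    ∑ p, pairCoeff u v p ^ 2 ≤ 2 * ((∑ i, u i ^ 2) * ∑ j, v j ^ 2) := by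
  have hcard : ∀ p : IndexPair N,
      (Finset.univ.filter fun ij : Fin N × Fin N => indexPair ij = p).card ≤ 2 := fun p => by
    refine (Finset.card_le_card (t := {(p.1.1, p.1.2), (p.1.2, p.1.1)}) ?_).trans
      Finset.card_le_two
    rintro ⟨i, j⟩ hij
    have h := (Finset.mem_filter.mp hij).2
    subst h
    rcases le_total i j with h | h <;> simp [indexPair, h]
  calc ∑ p, pairCoeff u v p ^ 2
      ≤ ∑ p, 2 * ∑ ij : Fin N × Fin N with indexPair ij = p, (u ij.1 * v ij.2) ^ 2 := by
        refine Finset.sum_le_sum fun p _ => (sq_sum_le_card_mul_sum_sq).trans ?_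
        have : ((Finset.univ.filter fun ij : Fin N × Fin N => indexPair ij = p).card : ℝ) ≤ 2 := by
          exact_mod_cast hcard p
        exact mul_le_mul_of_nonneg_right this (Finset.sum_nonneg fun _ _ => sq_nonneg _)
    _ = 2 * ∑ ij : Fin N × Fin N, (u ij.1 * v ij.2) ^ 2 := by
        rw [← Finset.mul_sum, Finset.sum_fiberwise]
    _ = _ := by
        rw [Fintype.sum_prod_type, Finset.sum_mul_sum]
        simp only [mul_pow]

end Pairs

/-! ### The three exceptional events: kernel, columns, online losses. -/

section Concentration

variable {X : Type*} {N m : ℕ} {q : X → X → ℝ}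

/-- The error of the kernel estimate. -/
noncomputable def kernelError (q : X → X → ℝ) (x : Fin N → X)
    (U : IndexPair N × Fin m → unitInterval) : Matrix (Fin N) (Fin N) ℝ :=
  Matrix.of fun i j => thresholdKernel (extendThresholds U) q x i j - q (x i) (x j)

theorem kernelError_apply (hm : 0 < m) (hsymm : ∀ a b, q a b = q b a) (x : Fin N → X)
    (U : IndexPair N × Fin m → unitInterval) (i j : Fin N) :
    kernelError q x U i j = (∑ k, centredBernoulli
      (q (x (indexPair (i, j)).1.1) (x (indexPair (i, j)).1.2)) (U (indexPair (i, j), k))) / m := by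
  have h : q (x i) (x j) = q (x (min i j)) (x (max i j)) := by
    rcases le_total i j with h | h
    · simp [h]
    · simp [h, hsymm (x i)]
  rw [kernelError, Matrix.of_apply, h]
  exact thresholdKernel_sub hm U q x i j

variable (h0 : ∀ a b, 0 ≤ q a b) (h1 : ∀ a b, q a b ≤ 1)

include h0 h1 in
theorem volume_bilinear_kernelError_le (hm : 0 < m) (hsymm : ∀ a b, q a b = q b a)
    (x : Fin N → X) (u v : Fin N → ℝ) {s : ℝ} (hs : 0 ≤ s) :
    (volume : Measure (IndexPair N × Fin m → unitInterval))
      {U | s * (2 * ((∑ i, u i ^ 2) * ∑ j, v j ^ 2)) / m < (u ⬝ᵥ kernelError q x U *ᵥ v) ^ 2} ≤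
      ENNReal.ofReal (2 * Real.exp (-(2 * s))) := by
  have hm' : (0 : ℝ) < m := by exact_mod_cast hm
  have h := volume_sq_sum_centredBernoulli_le
    (q := fun κ : IndexPair N × Fin m => q (x κ.1.1.1) (x κ.1.1.2)) (fun _ => h0 _ _)
    (fun _ => h1 _ _) Function.injective_id (fun κ => pairCoeff u v κ.1 / m) s
  refine (measure_mono fun U hU => ?_).trans h
  have hform : ∑ κ : IndexPair N × Fin m, pairCoeff u v κ.1 / m *
      centredBernoulli (q (x (id κ).1.1.1) (x (id κ).1.1.2)) (U (id κ)) =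
      u ⬝ᵥ kernelError q x U *ᵥ v := by
    rw [Fintype.sum_prod_type]
    have e : ∀ p : IndexPair N, ∑ k, pairCoeff u v p / m *
        centredBernoulli (q (x p.1.1) (x p.1.2)) (U (p, k)) =
        pairCoeff u v p * ((∑ k, centredBernoulli (q (x p.1.1) (x p.1.2)) (U (p, k))) / m) :=
      fun p => by rw [← Finset.mul_sum]; ring
    simp only [id, e, sum_pairCoeff_mul, dotProduct, Matrix.mulVec, Finset.mul_sum]
    refine Finset.sum_congr rfl fun i _ => Finset.sum_congr rfl fun j _ => ?_
    rw [kernelError_apply hm hsymm]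
    ring
  change s * ∑ κ : IndexPair N × Fin m, (pairCoeff u v κ.1 / m) ^ 2 < _
  rw [hform]
  refine lt_of_le_of_lt ?_ hU
  have e : ∑ κ : IndexPair N × Fin m, (pairCoeff u v κ.1 / m) ^ 2 =
      (∑ p, pairCoeff u v p ^ 2) / m := by
    rw [Fintype.sum_prod_type]
    simp only [Finset.sum_const, Finset.card_univ, Fintype.card_fin, nsmul_eq_mul, Finset.sum_div]
    refine Finset.sum_congr rfl fun p _ => ?_
    field_simp
  rw [e, mul_div_assoc]
  gcongr
  exact sum_pairCoeff_sq_le u v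

/-- The weights of kernel ridge regression trained on the first `t` points. -/
noncomputable def sampleWeights (lam : ℝ) (f : X → ℝ) (q : X → X → ℝ) (x : Fin N → X)
    (U : IndexPair N × Fin m → unitInterval) (t : Fin N) : Fin t → ℝ :=
  ridgeWeights lam (initialSegment (fun i => f (x i)) t.2.le)
    (thresholdKernel (extendThresholds U) q (initialSegment x t.2.le))

theorem sampleWeights_congr (lam : ℝ) (f : X → ℝ) (x : Fin N → X) (t : Fin N)
    {U U' : IndexPair N × Fin m → unitInterval}
    (h : ∀ (p : IndexPair N) (k : Fin m), p.1.2 < t → U (p, k) = U' (p, k)) :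
    sampleWeights lam f q x U t = sampleWeights lam f q x U' t := by
  have hV : ∀ i j, j < (t : ℕ) → ∀ k, extendThresholds U i j k = extendThresholds U' i j k := by
    intro i j hj k
    unfold extendThresholds
    split_ifs with hij
    · exact h _ k hj
    · rfl
  unfold sampleWeights
  congr 1
  ext i j
  simp only [thresholdKernel, fun k => hV (min i j : Fin t) (max i j : Fin t) (max i j).2 k]

variable [MeasurableSpace X]

theorem measurable_sampleWeights {Ω : Type*} [MeasurableSpace Ω] (lam : ℝ) {f : X → ℝ}
    (hf : Measurable f) (hq : Measurable (Function.uncurry q)) (t : Fin N) {x : Ω → Fin N → X}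
    (hx : Measurable x) {U : Ω → IndexPair N × Fin m → unitInterval} (hU : Measurable U) :
    Measurable fun ω => sampleWeights lam f q (x ω) (U ω) t := by
  refine measurable_ridgeWeights lam ?_ ?_
  · exact measurable_pi_iff.mpr fun i => hf.comp ((measurable_pi_apply _).comp hx)
  · exact measurable_thresholdKernel hq (fun i j k => (measurable_extendThresholds i j k).comp hU)
      ((measurable_initialSegment _).comp hx)

omit [MeasurableSpace X] in
include h0 h1 in
-- The sum involves only tests of the pairs (i, t) with i < t, whereas the weights see only pairs
-- whose larger index is below t. They are thus predictable, and Hoeffding applies as for constants.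
theorem volume_column_error_le (hm : 0 < m) (hsymm : ∀ a b, q a b = q b a) (x : Fin N → X)
    (t : Fin N) {w : (IndexPair N × Fin m → unitInterval) → Fin t → ℝ} (hwm : Measurable w)
    (hw : ∀ U U', (∀ (p : IndexPair N) (k : Fin m), p.1.2 < t → U (p, k) = U' (p, k)) → w U = w U')
    (s : ℝ) :
    (volume : Measure (IndexPair N × Fin m → unitInterval))
      {U | s * (∑ i, w U i ^ 2) / m <
        (∑ i, w U i * kernelError q x U (Fin.castLE t.2.le i) t) ^ 2} ≤
      ENNReal.ofReal (2 * Real.exp (-(2 * s))) := by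
  have hm' : (0 : ℝ) < m := by exact_mod_cast hm
  let φ : Fin t × Fin m → IndexPair N × Fin m := fun ik =>
    (⟨(Fin.castLE t.2.le ik.1, t), Fin.le_def.mpr ik.1.2.le⟩, ik.2)
  have hφ : φ.Injective := by
    rintro ⟨i, k⟩ ⟨i', k'⟩ h
    simp only [φ, Prod.mk.injEq, Subtype.mk.injEq, and_true] at h
    exact Prod.ext (Fin.castLE_injective _ h.1) h.2
  have hcm : Measurable fun (U : IndexPair N × Fin m → unitInterval) (ik : Fin t × Fin m) =>
      w U ik.1 / m :=
    measurable_pi_iff.mpr fun ik => ((measurable_pi_apply ik.1).comp hwm).div_const _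
  have hc : ∀ U U' : IndexPair N × Fin m → unitInterval, (∀ k ∉ Set.range φ, U k = U' k) →
      (fun ik : Fin t × Fin m => w U ik.1 / m) = fun ik => w U' ik.1 / m := fun U U' hUU' => by
    have : w U = w U' := by
      refine hw U U' fun p k hp => hUU' (p, k) ?_
      rintro ⟨ik, hik⟩
      have h : t = p.1.2 := congrArg (fun κ : IndexPair N × Fin m => κ.1.1.2) hik
      exact hp.ne' h
    rw [this]
  have h := volume_sq_sum_predictable_le
    (q := fun κ : IndexPair N × Fin m => q (x κ.1.1.1) (x κ.1.1.2)) (fun _ => h0 _ _)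
    (fun _ => h1 _ _) hφ hcm hc s
  refine le_trans (le_of_eq (congrArg _ (Set.ext fun U => ?_))) h
  have hform : ∑ ik : Fin t × Fin m, w U ik.1 / m *
      centredBernoulli (q (x (φ ik).1.1.1) (x (φ ik).1.1.2)) (U (φ ik)) =
      ∑ i, w U i * kernelError q x U (Fin.castLE t.2.le i) t := by
    rw [Fintype.sum_prod_type]
    refine Finset.sum_congr rfl fun i _ => ?_
    have hp : indexPair (Fin.castLE t.2.le i, t) =
        ⟨(Fin.castLE t.2.le i, t), Fin.le_def.mpr i.2.le⟩ := by
      have : Fin.castLE t.2.le i ≤ t := Fin.le_def.mpr i.2.le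
      simp [indexPair, this]
    rw [kernelError_apply hm hsymm, hp]
    simp only [φ]
    rw [← Finset.mul_sum]
    ring
  have e : ∑ ik : Fin t × Fin m, (w U ik.1 / m) ^ 2 = (∑ i, w U i ^ 2) / m := by
    rw [Fintype.sum_prod_type]
    simp only [Finset.sum_const, Finset.card_univ, Fintype.card_fin, nsmul_eq_mul, Finset.sum_div]
    refine Finset.sum_congr rfl fun p _ => ?_
    field_simp
  simp only [Set.mem_ofPred_eq, hform, e, mul_div_assoc]

theorem measurable_kernelError (hq : Measurable (Function.uncurry q)) (i j : Fin N) :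
    Measurable fun ω : (Fin N → X) × (IndexPair N × Fin m → unitInterval) =>
      kernelError q ω.1 ω.2 i j := by
  refine Measurable.sub ?_ ?_
  · exact (measurable_pi_apply j).comp ((measurable_pi_apply i).comp (measurable_thresholdKernel hq
      (fun i j k => (measurable_extendThresholds i j k).comp measurable_snd) measurable_fst))
  · have h : Measurable fun ω : (Fin N → X) × (IndexPair N × Fin m → unitInterval) =>
        (ω.1 i, ω.1 j) := ((measurable_pi_apply i).comp measurable_fst).prodMk
      ((measurable_pi_apply j).comp measurable_fst)
    exact hq.comp h

theorem measurable_bilinear_kernelError (hq : Measurable (Function.uncurry q)) (u v : Fin N → ℝ) :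
    Measurable fun ω : (Fin N → X) × (IndexPair N × Fin m → unitInterval) =>
      u ⬝ᵥ kernelError q ω.1 ω.2 *ᵥ v := by
  simp only [dotProduct, Matrix.mulVec]
  exact Finset.measurable_fun_sum _ fun i _ => (Finset.measurable_fun_sum _ fun j _ =>
    (measurable_kernelError hq i j).mul_const _).const_mul _

/-- The event that the empirical kernel matrix is far from the kernel matrix. -/
def badKernel (m : ℕ) (q : X → X → ℝ) (lam : ℝ) :
    Set ((Fin N → X) × (IndexPair N × Fin m → unitInterval)) :=
  {ω | ∃ u v : Fin N → ℝ, (4 * lam) ^ 2 * ((u ⬝ᵥ u) * (v ⬝ᵥ v)) <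
    (u ⬝ᵥ kernelError q ω.1 ω.2 *ᵥ v) ^ 2}

include h0 h1 in
theorem measure_badKernel_le (μ : Measure X) [IsProbabilityMeasure μ] (hm : 0 < m)
    (hsymm : ∀ a b, q a b = q b a) (hq : Measurable (Function.uncurry q)) {lam : ℝ}
    (hlam : 0 < lam) :
    ((Measure.pi fun _ : Fin N => μ).prod volume) (badKernel (N := N) m q lam) ≤
      ENNReal.ofReal (25 ^ N * (2 * Real.exp (-(m * lam ^ 2)))) := by
  have hm' : (0 : ℝ) < m := by exact_mod_cast hm
  obtain ⟨T, hcard, hT2, hT⟩ := exists_finset_norm_sub_le_one (E := EuclideanSpace ℝ (Fin N))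
  rw [finrank_euclideanSpace_fin] at hcard
  let S : EuclideanSpace ℝ (Fin N) × EuclideanSpace ℝ (Fin N) →
      Set ((Fin N → X) × (IndexPair N × Fin m → unitInterval)) := fun p =>
    {ω | (4 * lam) ^ 2 < (p.1.ofLp ⬝ᵥ kernelError q ω.1 ω.2 *ᵥ p.2.ofLp) ^ 2}
  have hsub : badKernel (N := N) m q lam ⊆ ⋃ p ∈ T ×ˢ T, S p := by
    rintro ω ⟨u, v, huv⟩
    by_contra hω
    simp only [Set.mem_iUnion, not_exists] at hω
    refine absurd huv (not_lt.mpr ?_)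
    let B : EuclideanSpace ℝ (Fin N) →ₗ[ℝ] EuclideanSpace ℝ (Fin N) →ₗ[ℝ] ℝ :=
      LinearMap.mk₂ ℝ (fun u v => u.ofLp ⬝ᵥ kernelError q ω.1 ω.2 *ᵥ v.ofLp)
        (fun u u' v => by simp [add_dotProduct]) (fun c u v => by simp)
        (fun u v v' => by simp [Matrix.mulVec_add]) (fun c u v => by simp [Matrix.mulVec_smul])
    have h := bilinear_le_of_net hT B (t := 4 * lam) (by positivity) (fun u hu v hv => by
      have := hω (u, v) (Finset.mk_mem_product hu hv)
      exact abs_le_of_sq_le_sq (not_lt.mp this) (by positivity))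
      (WithLp.toLp 2 u) (WithLp.toLp 2 v)
    have hsq : ∀ u : Fin N → ℝ, ‖(WithLp.toLp 2 u : EuclideanSpace ℝ (Fin N))‖ ^ 2 = u ⬝ᵥ u :=
      fun u => by
      rw [EuclideanSpace.norm_sq_eq]
      simp [dotProduct, sq]
    calc (u ⬝ᵥ kernelError q ω.1 ω.2 *ᵥ v) ^ 2
        = |B (WithLp.toLp 2 u) (WithLp.toLp 2 v)| ^ 2 := by rw [sq_abs]; rfl
      _ ≤ _ := pow_le_pow_left₀ (abs_nonneg _) h 2
      _ = _ := by rw [mul_pow, mul_pow, hsq, hsq]; ring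
  have hS : ∀ p ∈ T ×ˢ T, ((Measure.pi fun _ : Fin N => μ).prod volume) (S p) ≤
      ENNReal.ofReal (2 * Real.exp (-(m * lam ^ 2))) := fun p hp => by
    obtain ⟨hp1, hp2⟩ := Finset.mem_product.mp hp
    refine prod_le_of_forall_left (measurableSet_lt measurable_const
      ((measurable_bilinear_kernelError hq _ _).pow_const 2)) fun x => ?_
    -- For this s the tail threshold is λ²|u|²|v|², which is at most (4λ)² because net vectors have
    -- norm at most 2.
    have h := volume_bilinear_kernelError_le h0 h1 hm hsymm x p.1.ofLp p.2.ofLp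
      (s := m * lam ^ 2 / 2) (by positivity)
    rw [show 2 * (m * lam ^ 2 / 2) = m * lam ^ 2 by ring] at h
    refine le_trans (measure_mono fun U hU => ?_) h
    refine lt_of_le_of_lt ?_ (show (4 * lam) ^ 2 <
      (p.1.ofLp ⬝ᵥ kernelError q x U *ᵥ p.2.ofLp) ^ 2 from hU)
    have hn : ∀ u ∈ T, ∑ i, u.ofLp i ^ 2 ≤ 4 := fun u hu => by
      have := EuclideanSpace.norm_sq_eq u
      simp only [Real.norm_eq_abs, sq_abs] at this
      rw [← this]
      have := hT2 u hu
      nlinarith [norm_nonneg u]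
    have e : m * lam ^ 2 / 2 * (2 * ((∑ i, p.1.ofLp i ^ 2) * ∑ j, p.2.ofLp j ^ 2)) / m =
        lam ^ 2 * ((∑ i, p.1.ofLp i ^ 2) * ∑ j, p.2.ofLp j ^ 2) := by
      field_simp
    rw [e]
    calc _ ≤ lam ^ 2 * (4 * 4) := by
          gcongr
          · exact hn _ hp1
          · exact hn _ hp2
      _ = _ := by ring
  have hc : ((T ×ˢ T).card : ENNReal) ≤ ENNReal.ofReal (25 ^ N) := by
    rw [Finset.card_product, ← ENNReal.ofReal_natCast]
    refine ENNReal.ofReal_le_ofReal ?_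
    rw [show (25 : ℝ) = 5 * 5 by norm_num, mul_pow]
    exact_mod_cast Nat.mul_le_mul hcard hcard
  calc _ ≤ _ := measure_mono hsub
    _ ≤ ∑ p ∈ T ×ˢ T, _ := measure_biUnion_finset_le _ _
    _ ≤ ∑ p ∈ T ×ˢ T, ENNReal.ofReal (2 * Real.exp (-(m * lam ^ 2))) := Finset.sum_le_sum hS
    _ ≤ _ := by
      rw [Finset.sum_const, nsmul_eq_mul, ENNReal.ofReal_mul (p := 25 ^ N) (by positivity)]
      exact mul_le_mul_left hc _

/-- The event that the error of the `t`-th column of the empirical kernel matrix is correlated with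
the weights computed before that column. -/
def badColumn (m : ℕ) (q : X → X → ℝ) (f : X → ℝ) (lam : ℝ) (t : Fin N) :
    Set ((Fin N → X) × (IndexPair N × Fin m → unitInterval)) :=
  {ω | lam ^ 2 / N * ∑ i, sampleWeights lam f q ω.1 ω.2 t i ^ 2 <
    (∑ i, sampleWeights lam f q ω.1 ω.2 t i *
      kernelError q ω.1 ω.2 (Fin.castLE t.2.le i) t) ^ 2}

theorem measurableSet_badColumn (hq : Measurable (Function.uncurry q)) (lam : ℝ)
    {f : X → ℝ} (hf : Measurable f) (t : Fin N) : MeasurableSet (badColumn m q f lam t) := by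
  have hw : ∀ i : Fin t, Measurable fun ω : (Fin N → X) × (IndexPair N × Fin m → unitInterval) =>
      sampleWeights lam f q ω.1 ω.2 t i := fun i =>
    (measurable_pi_apply i).comp (measurable_sampleWeights lam hf hq t measurable_fst measurable_snd)
  refine measurableSet_lt ?_ ?_
  · exact (Finset.measurable_fun_sum _ fun i _ => (hw i).pow_const 2).const_mul _
  · exact (Finset.measurable_fun_sum _ fun i _ =>
      (hw i).mul (measurable_kernelError hq _ _)).pow_const 2

include h0 h1 in
theorem measure_badColumn_le (μ : Measure X) [IsProbabilityMeasure μ] (hm : 0 < m)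
    (hsymm : ∀ a b, q a b = q b a) (hq : Measurable (Function.uncurry q)) (lam : ℝ)
    {f : X → ℝ} (hf : Measurable f) (t : Fin N) :
    ((Measure.pi fun _ : Fin N => μ).prod volume) (badColumn m q f lam t) ≤
      ENNReal.ofReal (2 * Real.exp (-(2 * (m * lam ^ 2 / N)))) := by
  have hm' : (0 : ℝ) < m := by exact_mod_cast hm
  refine prod_le_of_forall_left (measurableSet_badColumn hq lam hf t) fun x => ?_
  have hwm : Measurable fun U : IndexPair N × Fin m → unitInterval =>
      sampleWeights lam f q x U t :=
    measurable_sampleWeights lam hf hq t measurable_const measurable_id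
  have h := volume_column_error_le h0 h1 hm hsymm x t hwm
    (fun U U' hU => sampleWeights_congr lam f x t hU) (m * lam ^ 2 / N)
  refine le_trans (le_of_eq (congrArg _ (Set.ext fun U => ?_))) h
  have e : m * lam ^ 2 / N * (∑ i, sampleWeights lam f q x U t i ^ 2) / m =
    lam ^ 2 / N * ∑ i, sampleWeights lam f q x U t i ^ 2 := by field_simp
  simp only [Set.mem_ofPred_eq, e]
  rfl

/-- The event that the online losses are much larger in expectation than observed. -/
def badOnline (m : ℕ) (μ : Measure X) (q : X → X → ℝ) (f : X → ℝ) (lam ε : ℝ) :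
    Set ((Fin N → X) × (IndexPair N × Fin m → unitInterval)) :=
  {ω | ε ≤ lossExcess μ (ridgeLoss lam f q (extendThresholds ω.2)) N ω.1}

/-- With the thresholds frozen, the t-th loss function depends only on the first t of the i.i.d.
points, which is the setting of Azuma's inequality. -/
theorem measure_badOnline_le (μ : Measure X) [IsProbabilityMeasure μ] (hN : 0 < N)
    (hq : Measurable (Function.uncurry q)) (lam : ℝ) {f : X → ℝ} (hf : Measurable f)
    (hf1 : ∀ z, |f z| ≤ 1) {ε : ℝ} (hε : 0 ≤ ε) :
    ((Measure.pi fun _ : Fin N => μ).prod volume) (badOnline (N := N) m μ q f lam ε) ≤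
      ENNReal.ofReal (Real.exp (-(ε ^ 2 / (2 * N)))) := by
  refine prod_le_of_forall_right
    (measurableSet_le measurable_const (measurable_lossExcess_ridgeLoss μ lam hf hq)) fun U => ?_
  have hl : ∀ n, Measurable (Function.uncurry (ridgeLoss lam f q (extendThresholds U) n)) :=
    fun n => measurable_ridgeLoss (Ω := (Fin n → X) × X) (V := fun _ => extendThresholds U) lam hf
      hq (fun i j k => measurable_const) measurable_fst measurable_snd
  exact measure_lossExcess_ge_le μ hl (ridgeLoss_mem_Icc lam hf1 q (extendThresholds U)) hN hε

end Concentration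

/-! ### Numerical consequences of the lower bound on m. -/

section Tails

variable {N m : ℕ} {lam δ : ℝ}

theorem samples_pos (hN : 0 < N) (hlam : 0 < lam) (hδ : 0 < δ) (hδ1 : δ < 1)
    (hm : (8 * (N : ℝ) / lam ^ 2) * Real.log (2 * (N : ℝ) / δ) ≤ (m : ℝ)) : 0 < m := by
  have hN' : (1 : ℝ) ≤ N := by exact_mod_cast hN
  have : 0 < Real.log (2 * (N : ℝ) / δ) := Real.log_pos (by rw [lt_div_iff₀ hδ]; linarith)
  have h : (0 : ℝ) < m := lt_of_lt_of_le (by positivity) hm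
  exact_mod_cast h

theorem le_samples_mul_sq (hlam : 0 < lam)
    (hm : (8 * (N : ℝ) / lam ^ 2) * Real.log (2 * (N : ℝ) / δ) ≤ (m : ℝ)) :
    8 * N * Real.log (2 * (N : ℝ) / δ) ≤ m * lam ^ 2 := by
  rw [div_mul_eq_mul_div, div_le_iff₀ (by positivity)] at hm
  exact hm

theorem exp_neg_log_two_mul_div (hN : 0 < N) (hδ : 0 < δ) (k : ℕ) :
    Real.exp (-(k * Real.log (2 * (N : ℝ) / δ))) = (δ / (2 * N)) ^ k := by
  have hN' : (0 : ℝ) < N := by exact_mod_cast hN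
  rw [← mul_neg, ← Real.log_inv, inv_div, Real.exp_nat_mul, Real.exp_log (by positivity)]

/-- With r = δ/(2N) the hypothesis on m gives exp(-mλ²) ≤ r^(8N): the factor N in m is what absorbs
the 25^N pairs of net points. -/
theorem net_tail_le (hN : 0 < N) (hlam : 0 < lam) (hδ : 0 < δ) (hδ1 : δ < 1)
    (hm : (8 * (N : ℝ) / lam ^ 2) * Real.log (2 * (N : ℝ) / δ) ≤ (m : ℝ)) :
    25 ^ N * (2 * Real.exp (-(m * lam ^ 2))) ≤ δ / 4 := by
  have hN' : (1 : ℝ) ≤ N := by exact_mod_cast hN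
  set r := δ / (2 * N) with hr
  have hr0 : 0 < r := by positivity
  have hrδ : r ≤ δ / 2 := div_le_div_of_nonneg_left hδ.le (by norm_num) (by linarith)
  have he : Real.exp (-(m * lam ^ 2)) ≤ (r ^ 8) ^ N := by
    rw [← pow_mul, hr, ← exp_neg_log_two_mul_div hN hδ]
    refine Real.exp_le_exp.mpr (neg_le_neg ?_)
    push_cast
    exact le_samples_mul_sq hlam hm
  have h7 : r ^ 7 ≤ (1 / 2) ^ 7 := pow_le_pow_left₀ hr0.le (by linarith) 7
  -- Since r ≤ 1/2, 25r⁷ ≤ 25/128 < 1/4.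
  have h8 : 25 * r ^ 8 ≤ 1 / 4 * r := by
    have : r ^ 8 = r ^ 7 * r := by ring
    rw [this]
    norm_num at h7
    nlinarith
  calc 25 ^ N * (2 * Real.exp (-(m * lam ^ 2))) ≤ 25 ^ N * (2 * (r ^ 8) ^ N) := by gcongr
    _ = 2 * (25 * r ^ 8) ^ N := by rw [mul_pow]; ring
    _ ≤ 2 * (25 * r ^ 8) := by
        gcongr
        exact pow_le_of_le_one (by positivity) (by linarith) hN.ne'
    _ ≤ δ / 4 := by linarith

theorem column_tail_le (hN : 0 < N) (hlam : 0 < lam) (hδ : 0 < δ) (hδ1 : δ < 1)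
    (hm : (8 * (N : ℝ) / lam ^ 2) * Real.log (2 * (N : ℝ) / δ) ≤ (m : ℝ)) :
    N * (2 * Real.exp (-(2 * (m * lam ^ 2 / N)))) ≤ δ / 4 := by
  have hN' : (1 : ℝ) ≤ N := by exact_mod_cast hN
  have hN0 : (0 : ℝ) < N := by linarith
  set r := δ / (2 * N) with hr
  have hr0 : 0 < r := by positivity
  have hrδ : r ≤ δ / 2 := div_le_div_of_nonneg_left hδ.le (by norm_num) (by linarith)
  have he : Real.exp (-(2 * (m * lam ^ 2 / N))) ≤ r ^ 16 := by
    rw [hr, ← exp_neg_log_two_mul_div hN hδ]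
    refine Real.exp_le_exp.mpr (neg_le_neg ?_)
    have := le_samples_mul_sq hlam hm
    rw [← mul_div_assoc, le_div_iff₀ hN0]
    push_cast
    linarith
  have h15 : r ^ 15 ≤ 1 / 4 :=
    (pow_le_pow_left₀ hr0.le (show r ≤ 1 / 2 by linarith) 15).trans (by norm_num)
  calc N * (2 * Real.exp (-(2 * (m * lam ^ 2 / N)))) ≤ N * (2 * r ^ 16) := by gcongr
    _ = (2 * N * r) * r ^ 15 := by ring
    _ = δ * r ^ 15 := by
        rw [hr]
        field_simp
    _ ≤ δ * (1 / 4) := by gcongr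
    _ = δ / 4 := by ring

/-- The only source of the dependence on δ₀: log(1/δ) tends to 0 as δ tends to 1, but log(2/δ) does
not. -/
theorem log_two_div_le {δ₀ : ℝ} (hδ : 0 < δ) (hδδ₀ : δ ≤ δ₀) (hδ₀ : δ₀ < 1) :
    Real.log (2 / δ) ≤ (1 + Real.log 2 / Real.log (1 / δ₀)) * Real.log (1 / δ) := by
  have hδ₀0 : 0 < δ₀ := hδ.trans_le hδδ₀
  have h1 : 0 < Real.log (1 / δ₀) := Real.log_pos (by rw [lt_div_iff₀ hδ₀0]; linarith)
  have h2 : Real.log (1 / δ₀) ≤ Real.log (1 / δ) :=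
    Real.log_le_log (by positivity) (one_div_le_one_div_of_le hδ hδδ₀)
  have h3 : Real.log (2 / δ) = Real.log 2 + Real.log (1 / δ) := by
    rw [← Real.log_mul (by norm_num) (by positivity)]
    congr 1
    ring
  have h4 : Real.log 2 ≤ Real.log 2 / Real.log (1 / δ₀) * Real.log (1 / δ) := by
    rw [div_mul_eq_mul_div, le_div_iff₀ h1]
    exact mul_le_mul_of_nonneg_left h2 (Real.log_nonneg (by norm_num))
  rw [h3]
  linarith

end Tails

/-! ### From online losses to the risk of the averaged predictor. -/

section Risk

variable {X : Type*} {N m : ℕ}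

theorem onlineRidge_thresholdKernel (lam : ℝ) (f : X → ℝ) (q : X → X → ℝ)
    (V : ℕ → ℕ → Fin m → unitInterval) (x : Fin N → X) (z : X) :
    onlineRidge N lam (fun i => f (x i)) (thresholdKernel V q x) (fun i => q (x i) z) =
      (∑ t : Fin N, ridgePrediction lam (fun i => f (initialSegment x t.2.le i))
        (thresholdKernel V q (initialSegment x t.2.le))
        (fun i => q (initialSegment x t.2.le i) z)) / N := by
  simp only [onlineRidge, leadingBlock_thresholdKernel]
  rfl

theorem abs_onlineRidge_sub_le (hN : 0 < N) (lam : ℝ) (f : X → ℝ) (q : X → X → ℝ)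
    (V : ℕ → ℕ → Fin m → unitInterval) (x : Fin N → X) (z : X) :
    |onlineRidge N lam (fun i => f (x i)) (thresholdKernel V q x) (fun i => q (x i) z) - f z| ≤
      (∑ t : Fin N, ridgeLoss lam f q V t (initialSegment x t.2.le) z) / N := by
  have hN' : (0 : ℝ) < N := by exact_mod_cast hN
  have e : f z = (∑ _t : Fin N, f z) / N := by
    simp
    field_simp
  rw [onlineRidge_thresholdKernel]
  nth_rw 1 [e]
  rw [← sub_div, ← Finset.sum_sub_distrib, abs_div, abs_of_pos hN']
  gcongr
  exact Finset.abs_sum_le_sum_abs _ _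

variable [MeasurableSpace X] (μ : Measure X) [IsProbabilityMeasure μ]

/-- By convexity of the absolute value, the risk of the average is at most the average of the risks,
which is the observed average plus the excess. -/
theorem risk_onlineRidge_le (hN : 0 < N) (lam : ℝ) {f : X → ℝ} (hf : Measurable f)
    (hf1 : ∀ z, |f z| ≤ 1) {q : X → X → ℝ} (hq : Measurable (Function.uncurry q))
    (V : ℕ → ℕ → Fin m → unitInterval) (x : Fin N → X) :
    Integrable (fun z => |onlineRidge N lam (fun i => f (x i)) (thresholdKernel V q x)
      (fun i => q (x i) z) - f z|) μ ∧
    ∫ z, |onlineRidge N lam (fun i => f (x i)) (thresholdKernel V q x)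
      (fun i => q (x i) z) - f z| ∂μ ≤ lossExcess μ (ridgeLoss lam f q V) N x / N +
        (∑ t : Fin N, ridgeLoss lam f q V t (initialSegment x t.2.le) (x t)) / N := by
  have hlm : ∀ t : Fin N, Measurable fun z =>
      ridgeLoss lam f q V t (initialSegment x t.2.le) z := fun t =>
    measurable_ridgeLoss (V := fun _ => V) (x := fun _ => initialSegment x t.2.le) lam hf hq
      (fun i j k => measurable_const) measurable_const measurable_id
  have hli : ∀ t : Fin N, Integrable (fun z =>
      ridgeLoss lam f q V t (initialSegment x t.2.le) z) μ := fun t =>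
    Integrable.of_mem_Icc 0 2 (hlm t).aemeasurable
      (Filter.Eventually.of_forall fun z => ridgeLoss_mem_Icc lam hf1 q V t _ z)
  have hsum : Integrable (fun z =>
      (∑ t : Fin N, ridgeLoss lam f q V t (initialSegment x t.2.le) z) / N) μ :=
    (integrable_finsetSum _ fun t _ => hli t).div_const _
  have hhm : Measurable fun z => |onlineRidge N lam (fun i => f (x i)) (thresholdKernel V q x)
      (fun i => q (x i) z) - f z| := by
    refine (Measurable.sub ?_ hf).abs
    have hk : Measurable fun z : X => fun i => q (x i) z :=
      measurable_pi_iff.mpr fun i => hq.comp measurable_prodMk_left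
    simp only [onlineRidge]
    exact Measurable.div_const (Finset.measurable_fun_sum _ fun t _ =>
      measurable_ridgePrediction lam measurable_const measurable_const
        ((measurable_initialSegment _).comp hk)) _
  have hint := hsum.mono' hhm.aestronglyMeasurable (Filter.Eventually.of_forall fun z => by
    rw [Real.norm_eq_abs, abs_abs]
    exact abs_onlineRidge_sub_le hN lam f q V x z)
  refine ⟨hint, (integral_mono hint hsum fun z =>
    abs_onlineRidge_sub_le hN lam f q V x z).trans_eq ?_⟩
  rw [integral_div, integral_finsetSum _ fun t _ => hli t, ← add_div, lossExcess,
    ← Finset.sum_add_distrib]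
  simp

end Risk

/-! ### Observed losses outside the exceptional events, and the theorem. -/

section Main

variable {X : Type*} {N m : ℕ}

theorem sum_ridgeLoss_le (hN : 0 < N) {lam p : ℝ} (hlam : 0 < lam) (hp0 : 0 ≤ p) (hp1 : p < 1)
    {D : ℕ} {ρ : X → Matrix (Fin D) (Fin D) ℂ} (hρ : ∀ x, IsDensityMatrix (ρ x))
    {f : X → ℝ} (hf1 : ∀ z, |f z| ≤ 1) {q : X → X → ℝ}
    (hq : q = fun a b => trProd (depolarize p (ρ a)) (depolarize p (ρ b)))
    (x : Fin N → X) (U : IndexPair N × Fin m → unitInterval)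
    (hker : (x, U) ∉ badKernel m q lam) (hcol : ∀ t, (x, U) ∉ badColumn m q f lam t) :
    (∑ t : Fin N, ridgeLoss lam f q (extendThresholds U) t (initialSegment x t.2.le) (x t)) / N ≤
      4 * Real.sqrt (max 1 lam * ((fun i => f (x i)) ⬝ᵥ ((kernelMatrix ρ x +
        lam • (1 : Matrix (Fin N) (Fin N) ℝ))⁻¹ *ᵥ fun i => f (x i))) / ((1 - p) ^ 2 * N)) := by
  have hN' : (0 : ℝ) < N := by exact_mod_cast hN
  have hpp : 0 < (1 - p) ^ 2 := by
    have : 0 < 1 - p := by linarith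
    positivity
  have hpp1 : (1 - p) ^ 2 ≤ 1 := by nlinarith
  set y : Fin N → ℝ := fun i => f (x i) with hy
  set K := kernelMatrix ρ x
  set G := K + lam • (1 : Matrix (Fin N) (Fin N) ℝ) with hGdef
  set Kn := kernelMatrix (fun z => depolarize p (ρ z)) x with hKn
  set Kh : Matrix (Fin N) (Fin N) ℝ := Matrix.of (thresholdKernel (extendThresholds U) q x) with hKh
  have hE : Kh = Kn + kernelError q x U := by
    ext i j
    simp [hKh, hKn, kernelError, kernelMatrix, hq]
  have hone : ∀ (c : ℝ) (v : Fin N → ℝ),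
      v ⬝ᵥ (c • (1 : Matrix (Fin N) (Fin N) ℝ)) *ᵥ v = c * (v ⬝ᵥ v) := fun c v => by
    simp [Matrix.smul_mulVec]
  have hG : G.IsSymm := (kernelMatrix_isSymm ρ x).add (Matrix.isSymm_one.smul _)
  have hvv : ∀ v : Fin N → ℝ, 0 ≤ v ⬝ᵥ v := fun v =>
    Finset.sum_nonneg fun i _ => mul_self_nonneg (v i)
  have hGq : ∀ v, v ⬝ᵥ G *ᵥ v = v ⬝ᵥ K *ᵥ v + lam * (v ⬝ᵥ v) := fun v => by
    rw [hGdef, Matrix.add_mulVec, dotProduct_add, hone]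
  have hKnn : ∀ v, 0 ≤ v ⬝ᵥ K *ᵥ v := kernelMatrix_quadratic_nonneg hρ x
  have hGpos : ∀ v, v ≠ 0 → 0 < v ⬝ᵥ G *ᵥ v := fun v hv => by
    rw [hGq]
    have : 0 < v ⬝ᵥ v := lt_of_le_of_ne (hvv v) fun h => hv (dotProduct_self_eq_zero.mp h.symm)
    have := hKnn v
    positivity
  have herr : ∀ v, -(4 * lam * (v ⬝ᵥ v)) ≤ v ⬝ᵥ kernelError q x U *ᵥ v := fun v => by
    have h : (v ⬝ᵥ kernelError q x U *ᵥ v) ^ 2 ≤ (4 * lam * (v ⬝ᵥ v)) ^ 2 := by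
      by_contra hlt
      refine hker ⟨v, v, ?_⟩
      have e : (4 * lam * (v ⬝ᵥ v)) ^ 2 = (4 * lam) ^ 2 * ((v ⬝ᵥ v) * (v ⬝ᵥ v)) := by ring
      rw [← e]
      exact not_le.mp hlt
    exact (abs_le.mp (abs_le_of_sq_le_sq h (mul_nonneg (by positivity) (hvv v)))).1
  -- Of the regularization 5λ, the part 4λ absorbs the kernel error and λ remains.
  have hM : ∀ v, (1 - p) ^ 2 * (v ⬝ᵥ K *ᵥ v) + lam * (v ⬝ᵥ v) ≤
      v ⬝ᵥ (Kh + (5 * lam) • (1 : Matrix (Fin N) (Fin N) ℝ)) *ᵥ v := fun v => by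
    rw [hE, Matrix.add_mulVec, dotProduct_add, hone, Matrix.add_mulVec, dotProduct_add]
    have h1 := kernelMatrix_depolarize_quadratic hρ hp0 hp1 x v
    have h2 := herr v
    linarith
  have hmain := sum_sq_residual_le hlam hpp (Kn := Kn) (Kh := Kh) hG hGpos
    (Matrix.IsSymm.ext fun i j => thresholdKernel_comm _ _ _ _ _)
    (fun v => by
      refine le_trans ?_ (hM v)
      rw [hGq, mul_add]
      have := mul_le_of_le_one_left (mul_nonneg hlam.le (hvv v)) hpp1
      linarith)
    (fun v => by
      have := mul_nonneg hpp.le (hKnn v)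
      linarith [hM v])
    (fun i => thresholdKernel_le_one _ _ _ _ _) y (fun t => sampleWeights lam f q x U t)
    (fun t => by
      rw [hKh]
      exact congrArg (ridgeWeights lam _) (leadingBlock_thresholdKernel _ _ _ _).symm)
    (fun t => by
      have h : (∑ i, sampleWeights lam f q x U t i *
          kernelError q x U (Fin.castLE t.2.le i) t) ^ 2 ≤
          lam ^ 2 / N * ∑ i, sampleWeights lam f q x U t i ^ 2 := not_lt.mp (hcol t)
      refine le_trans (le_of_eq ?_) h
      simp [hE])
  set Z := max 1 lam * (y ⬝ᵥ G⁻¹ *ᵥ y)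
  have hloss : ∀ t : Fin N, ridgeLoss lam f q (extendThresholds U) t (initialSegment x t.2.le) (x t)
      ≤ |y t - ∑ i, sampleWeights lam f q x U t i * Kn (Fin.castLE t.2.le i) t| := fun t => by
    rw [abs_sub_comm]
    have e : ∀ i : Fin t, Kn (Fin.castLE t.2.le i) t = q (initialSegment x t.2.le i) (x t) :=
      fun i => by simp [hKn, kernelMatrix, hq, initialSegment]
    simp only [e]
    exact abs_clip_sub_le (hf1 (x t))
  set S := ∑ t : Fin N, ridgeLoss lam f q (extendThresholds U) t (initialSegment x t.2.le) (x t)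
  have hS0 : 0 ≤ S := Finset.sum_nonneg fun t _ => abs_nonneg _
  -- Clipping reduces to the unclipped residuals, and Cauchy-Schwarz passes from absolute to squared
  -- losses.
  have hS : S ^ 2 ≤ N * (14 * (Z / (1 - p) ^ 2)) := by
    calc S ^ 2 ≤ (∑ t : Fin N,
          |y t - ∑ i, sampleWeights lam f q x U t i * Kn (Fin.castLE t.2.le i) t|) ^ 2 :=
          pow_le_pow_left₀ hS0 (Finset.sum_le_sum fun t _ => hloss t) 2
      _ ≤ _ := sq_sum_le_card_mul_sum_sq
      _ ≤ _ := by
          simp only [sq_abs, Finset.card_univ, Fintype.card_fin]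
          gcongr
  have hZ : 0 ≤ Z / (1 - p) ^ 2 := by
    have := (sq_nonneg S).trans hS
    have := (mul_nonneg_iff_of_pos_left hN').mp this
    linarith
  -- The constant 14 is rounded up to 16 to have an integral square root.
  have hfin : S / N ≤ Real.sqrt (16 * (Z / ((1 - p) ^ 2 * N))) := by
    refine Real.le_sqrt_of_sq_le ?_
    have e : 16 * (Z / ((1 - p) ^ 2 * N)) = N * (16 * (Z / (1 - p) ^ 2)) / N ^ 2 := by
      field_simp
    rw [div_pow, e]
    gcongr
    refine hS.trans ?_
    gcongr
    norm_num
  rwa [Real.sqrt_mul (by norm_num), show Real.sqrt 16 = 4 by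
    rw [show (16 : ℝ) = 4 ^ 2 by norm_num]; exact Real.sqrt_sq (by norm_num)] at hfin

end Main

theorem theorem2 :
    -- the learning rule knows nothing of the encoding, the noise, the observable, the
    -- distribution, or the confidence level
    ∃ A : KernelLearner, A.IsMeasurable ∧
    ∀ δ₀ : ℝ, δ₀ < 1 → ∃ C : ℝ, 0 < C ∧
    ∀ (X : Type*) [MeasurableSpace X] (μ : Measure X) [IsProbabilityMeasure μ]
      (D : ℕ) (ρ : X → Matrix (Fin D) (Fin D) ℂ)
      (O : Matrix (Fin D) (Fin D) ℂ) (p lam δ : ℝ) (N m : ℕ),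
      (∀ x, IsDensityMatrix (ρ x)) →
      (∀ a b, Measurable fun x => ρ x a b) →
      IsBoundedObservable O →
      0 ≤ p → p < 1 → 0 < lam → 0 < δ → δ ≤ δ₀ → 0 < N →
      (8 * (N : ℝ) / lam ^ 2) * Real.log (2 * (N : ℝ) / δ) ≤ (m : ℝ) →
      ENNReal.ofReal (1 - δ) ≤
        experimentLaw μ (fun z => depolarize p (ρ z)) N m
          {ω | -- the target function, the labels, the noiseless kernel matrix, the hypothesis
            let f : X → ℝ := fun z => trProd (ρ z) O
            let y : Fin N → ℝ := fun i => f (ω.1 i)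
            let K : Matrix (Fin N) (Fin N) ℝ := kernelMatrix ρ ω.1
            let h : X → ℝ := fun z => A N lam y (estimatedKernel ω.2)
              (kernelVector (fun w => depolarize p (ρ w)) ω.1 z)
            Integrable (fun z => |h z - f z|) μ ∧
            ∫ z, |h z - f z| ∂μ ≤
              C * (Real.sqrt (max 1 lam *
                      (y ⬝ᵥ ((K + lam • (1 : Matrix (Fin N) (Fin N) ℝ))⁻¹ *ᵥ y)) /
                      ((1 - p) ^ 2 * (N : ℝ))) +
                    Real.sqrt (Real.log (1 / δ) / (N : ℝ)))} := by
  refine ⟨onlineRidge, onlineRidge_isMeasurable, fun δ₀ hδ₀ => ?_⟩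
  -- The 4 comes from the observed losses, the root from the Azuma deviation. For δ₀ ≤ 0 no δ is
  -- admissible, and positivity of the constant holds all the same.
  refine ⟨4 + Real.sqrt (2 * (1 + Real.log 2 / Real.log (1 / δ₀))),
    add_pos_of_pos_of_nonneg (by norm_num) (Real.sqrt_nonneg _), ?_⟩
  intro X _ μ _ D ρ O p lam δ N m hρ hρm hO hp0 hp1 hlam hδ hδδ₀ hN hm
  have hδ1 : δ < 1 := hδδ₀.trans_lt hδ₀
  have hN' : (0 : ℝ) < N := by exact_mod_cast hN
  have hmpos := samples_pos hN hlam hδ hδ1 hm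
  set σ : X → Matrix (Fin D) (Fin D) ℂ := fun z => depolarize p (ρ z) with hσdef
  have hσ : ∀ z, IsDensityMatrix (σ z) := fun z => (hρ z).depolarize hp0 hp1
  have hσm : ∀ a b, Measurable fun z => σ z a b := measurable_depolarize hρm p
  set f : X → ℝ := fun z => trProd (ρ z) O with hf
  have hfm : Measurable f := measurable_trProd hρm fun _ _ => measurable_const
  have hf1 : ∀ z, |f z| ≤ 1 := fun z => abs_trProd_le_one (hρ z) hO
  set q : X → X → ℝ := fun a b => trProd (σ a) (σ b) with hq
  have hqm : Measurable (Function.uncurry q) :=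
    measurable_trProd (A := fun w : X × X => σ w.1) (B := fun w : X × X => σ w.2)
      (fun a b => (hσm a b).comp measurable_fst) fun a b => (hσm a b).comp measurable_snd
  have hq0 : ∀ a b, 0 ≤ q a b := fun a b => trProd_nonneg (hσ a).1 (hσ b).1
  have hq1 : ∀ a b, q a b ≤ 1 := fun a b => trProd_le_one (hσ a) (hσ b)
  have hqs : ∀ a b, q a b = q b a := fun a b => trProd_comm _ _
  have hlog : 0 < Real.log (2 / δ) := Real.log_pos (by rw [lt_div_iff₀ hδ]; linarith)
  -- Chosen so that exp(-ε²/(2N)) = δ/2; the kernel event and the columns together receive δ/4 each.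
  set ε := Real.sqrt (2 * N * Real.log (2 / δ)) with hε
  have hε2 : ε ^ 2 = 2 * N * Real.log (2 / δ) := Real.sq_sqrt (by positivity)
  let bad : Set ((Fin N → X) × (IndexPair N × Fin m → unitInterval)) :=
    (badKernel m q lam ∪ ⋃ t ∈ (Finset.univ : Finset (Fin N)), badColumn m q f lam t) ∪
      badOnline m μ q f lam ε
  refine measure_sub_le_experimentLaw μ hσ hσm hδ.le (bad := bad) ?_ ?_
  · rintro ⟨x, U⟩ hω
    simp only [bad, Set.mem_union, not_or, Set.mem_iUnion, not_exists] at hω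
    obtain ⟨⟨hker, hcol⟩, hon⟩ := hω
    have hrisk := risk_onlineRidge_le μ hN lam hfm hf1 hqm (extendThresholds U) x
    have hemp := sum_ridgeLoss_le hN hlam hp0 hp1 hρ hf1 hq x U hker
      fun t => hcol t (Finset.mem_univ t)
    have hexc : lossExcess μ (ridgeLoss lam f q (extendThresholds U)) N x ≤ ε :=
      (not_le.mp hon).le
    change Integrable (fun z => |onlineRidge N lam (fun i => f (x i))
      (estimatedKernel (swapSample σ x U)) (fun i => q (x i) z) - f z|) μ ∧
      ∫ z, |onlineRidge N lam (fun i => f (x i))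
      (estimatedKernel (swapSample σ x U)) (fun i => q (x i) z) - f z| ∂μ ≤ _
    rw [estimatedKernel_swapSample]
    refine ⟨hrisk.1, hrisk.2.trans ?_⟩
    have hdev : ε / N ≤ Real.sqrt (2 * (1 + Real.log 2 / Real.log (1 / δ₀))) *
        Real.sqrt (Real.log (1 / δ) / N) := by
      have hlog1 : 0 < Real.log (1 / δ) := Real.log_pos (by rw [lt_div_iff₀ hδ]; linarith)
      rw [← Real.sqrt_mul' _ (by positivity)]
      refine Real.le_sqrt_of_sq_le ?_
      rw [div_pow, hε2]
      have h := log_two_div_le hδ hδδ₀ hδ₀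
      calc 2 * N * Real.log (2 / δ) / N ^ 2 = 2 / N * Real.log (2 / δ) := by field_simp
        _ ≤ 2 / N * ((1 + Real.log 2 / Real.log (1 / δ₀)) * Real.log (1 / δ)) := by gcongr
        _ = _ := by ring
    have h1 : lossExcess μ (ridgeLoss lam f q (extendThresholds U)) N x / N ≤ ε / N := by gcongr
    rw [add_mul, mul_add, mul_add]
    refine (add_le_add (h1.trans hdev) hemp).trans ?_
    have n1 := mul_nonneg (Real.sqrt_nonneg (2 * (1 + Real.log 2 / Real.log (1 / δ₀))))
      (Real.sqrt_nonneg (max 1 lam * ((fun i => f (x i)) ⬝ᵥ ((kernelMatrix ρ x +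
        lam • (1 : Matrix (Fin N) (Fin N) ℝ))⁻¹ *ᵥ fun i => f (x i))) / ((1 - p) ^ 2 * N)))
    have n2 := Real.sqrt_nonneg (Real.log (1 / δ) / N)
    linarith
  · have hK := (measure_badKernel_le hq0 hq1 μ hmpos hqs hqm hlam (N := N)).trans
      (ENNReal.ofReal_le_ofReal (net_tail_le hN hlam hδ hδ1 hm))
    have hC : ((Measure.pi fun _ : Fin N => μ).prod volume)
        (⋃ t ∈ (Finset.univ : Finset (Fin N)), badColumn m q f lam t) ≤
        ENNReal.ofReal (δ / 4) := by
      refine (measure_biUnion_finset_le _ _).trans ((Finset.sum_le_sum fun t _ =>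
        measure_badColumn_le hq0 hq1 μ hmpos hqs hqm lam hfm t).trans ?_)
      rw [Finset.sum_const, Finset.card_univ, Fintype.card_fin, ← ENNReal.ofReal_nsmul,
        nsmul_eq_mul]
      exact ENNReal.ofReal_le_ofReal (column_tail_le hN hlam hδ hδ1 hm)
    have hA : ((Measure.pi fun _ : Fin N => μ).prod volume) (badOnline m μ q f lam ε) ≤
        ENNReal.ofReal (δ / 2) := by
      refine (measure_badOnline_le μ hN hqm lam hfm hf1 (Real.sqrt_nonneg _)).trans ?_
      refine ENNReal.ofReal_le_ofReal (le_of_eq ?_)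
      rw [hε2, mul_div_cancel_left₀ _ (by positivity), ← Real.log_inv, inv_div,
        Real.exp_log (by positivity)]
    calc _ ≤ _ := measure_union_le _ _
      _ ≤ (ENNReal.ofReal (δ / 4) + ENNReal.ofReal (δ / 4)) + ENNReal.ofReal (δ / 2) :=
        add_le_add ((measure_union_le _ _).trans (add_le_add hK hC)) hA
      _ = ENNReal.ofReal δ := by
        rw [← ENNReal.ofReal_add (by positivity) (by positivity),
          ← ENNReal.ofReal_add (by positivity) (by positivity)]
        congr 1
        ring
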